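/- Let $p\ge 2$ be an integer. For each $n\in\mathbb N$ let $A=(A_{i_1,\dots,i_p})_{1\le i_1,\dots,i_p\le n}$ be independent standard normal random variables, let $\mathbb B^n=\{x\in\mathbb R^n : x_i^2=\tfrac1n \text{ for all } i\}$, and set $$\zeta(p;\mathbb B^n,n)=\frac1{\sqrt n}\max_{x\in\mathbb B^n}\sum_{i_1,\dots,i_p=1}^n A_{i_1,\dots,i_p}\prod_{k=1}^p x_{i_k}.$$ Write $\operatorname{erfc}(x)=\frac{2}{\sqrt\pi}\int_x^\infty e^{-t^2}\,dt$. (i) Let $u\in\mathbb R$ and let $\hat c_3>0$ be a minimizer over $c_3>0$ of $$\frac{c_3^2}{2}+\log\operatorname{erfc}\Big(-\frac{c_3\sqrt p}{\sqrt 2}\Big)-c_3u .$$ Then $\hat c_3<u$, $$\frac{1}{\operatorname{erfc}\big(-\frac{\hat c_3\sqrt p}{\sqrt2}\big)}=e^{\hat c_3^2p/2}\,(u-\hat c_3)\sqrt{\frac{\pi}{2p}},$$ and with $$\phi_{\mathbb B^n}(p,u):=-\frac{\hat c_3^2}{2}(p-1)-\log(u-\hat c_3)-\hat c_3u-\frac12\log\frac{\pi}{2p}=\frac{\hat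 c_3^2}{2}+\log\operatorname{erfc}\Big(-\frac{\hat c_3\sqrt p}{\sqrt2}\Big)-\hat c_3u$$ one has $$\limsup_{n\to\infty}\frac1n\log\mathbb P\big(\zeta(p;\mathbb B^n,n)\ge u\big)\le\phi_{\mathbb B^n}(p,u).$$ (ii) Let $u_{GS}^{(sk)}=u_{GS}^{(sk)}(p)$ be the infimum of the set of all $u$ for which a minimizer $\hat c_3>0$ as in (i) exists and $\phi_{\mathbb B^n}(p,u)<0$. This set is nonempty and bounded below, a minimizer $\hat c_3>0$ exists for every $u\ge u_{GS}^{(sk)}$, and $$u_{GS}^{(sk)}=\min_{c_3>0}\Big(\frac{c_3}{2}+\frac1{c_3}\log\operatorname{erfc}\Big(-\frac{c_3\sqrt p}{\sqrt2}\Big)\Big),$$ where the minimum is attained. (iii) The expectations below are finite, and the ground state energies of the Ising $p$-spin model and of the Ising multipartite $p$-spin model satisfy $$\limsup_{n\to\infty}\frac1{\sqrt n}\,\mathbb E\max_{x\in\mathbb B^n}\sum_{i_1,\dots,i_p=1}^nA_{i_1,\dots,i_p}\prod_{j=1}^px_{i_j}\le u_{GS}^{(sk)},$$ $$\limsup_{n\to\infty}\frac1{\sqrt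 n}\,\mathbb E\max_{x^{(1)},\dots,x^{(p)}\in\mathbb B^n}\sum_{i_1,\dots,i_p=1}^nA_{i_1,\dots,i_p}\prod_{j=1}^px^{(j)}_{i_j}\le\sqrt p\;u_{GS}^{(sk)} .$$ -/

import Mathlib

open MeasureTheory ProbabilityTheory Filter Topology Set

noncomputable section

namespace PSpin

/-- The complementary error function `erfc x = (2 / √π) ∫_x^∞ e^{-t²} dt`. -/
def erfc (x : ℝ) : ℝ :=
  2 / Real.sqrt Real.pi * ∫ t in Ioi x, Real.exp (-t ^ 2)

/-- The Ising spin set `𝔹ⁿ = {x ∈ ℝⁿ : x_i² = 1/n}`. -/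
def isingCube (n : ℕ) : Set (Fin n → ℝ) :=
  {x | ∀ i, x i ^ 2 = 1 / (n : ℝ)}

theorem isingCube_nonempty (n : ℕ) : (isingCube n).Nonempty := by
  refine ⟨fun _ => Real.sqrt (1 / (n : ℝ)), fun _ => ?_⟩
  exact Real.sq_sqrt (by positivity)

theorem isingCube_finite (n : ℕ) : (isingCube n).Finite := by
  have h : ∀ _ : Fin n, ({Real.sqrt (1 / (n : ℝ)), -Real.sqrt (1 / (n : ℝ))} : Set ℝ).Finite :=
    fun _ => Set.toFinite _
  refine (Set.Finite.pi' h).subset fun x hx i => ?_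
  have h1 : x i ^ 2 = Real.sqrt (1 / (n : ℝ)) ^ 2 := by
    rw [Real.sq_sqrt (by positivity)]
    exact hx i
  simpa using sq_eq_sq_iff_eq_or_eq_neg.mp h1

variable {p n : ℕ}

/-- The multilinear form `∑_{i₁,…,i_p} a_{i₁,…,i_p} ∏_j x^{(j)}_{i_j}` of the tensor `a`. -/
def tensorForm (a : (Fin p → Fin n) → ℝ) (x : Fin p → Fin n → ℝ) : ℝ :=
  ∑ i : Fin p → Fin n, a i * ∏ j, x j (i j)

/-- `max_{x ∈ S} ∑ a_{i₁,…,i_p} ∏_j x_{i_j}`: a single spin vector. -/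
def singleMax (S : Set (Fin n → ℝ)) (a : (Fin p → Fin n) → ℝ) : ℝ :=
  ⨆ x : S, tensorForm a fun _ => (x : Fin n → ℝ)

/-- `max_{x^{(j)} ∈ S^{(j)}} ∑ a_{i₁,…,i_p} ∏_j x^{(j)}_{i_j}`: one spin vector for each `j`. -/
def multiMax (S : Fin p → Set (Fin n → ℝ)) (a : (Fin p → Fin n) → ℝ) : ℝ :=
  ⨆ x : (j : Fin p) → S j, tensorForm a fun j => (x j : Fin n → ℝ)

/-- The suprema over the (finite, nonempty) Ising sets are attained, i.e. they are maxima. -/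
theorem singleMax_isGreatest (a : (Fin p → Fin n) → ℝ) :
    IsGreatest ((fun x : Fin n → ℝ => tensorForm a fun _ => x) '' isingCube n)
      (singleMax (isingCube n) a) := by
  have : Finite (isingCube n) := (isingCube_finite n).to_subtype
  have : Nonempty (isingCube n) := (isingCube_nonempty n).to_subtype
  constructor
  · obtain ⟨x, hx⟩ := exists_eq_ciSup_of_finite
      (f := fun x : isingCube n => tensorForm a fun _ => (x : Fin n → ℝ))
    exact ⟨x, x.2, hx⟩
  · rintro _ ⟨x, hx, rfl⟩
    exact le_ciSup (f := fun x : isingCube n => tensorForm a fun _ => (x : Fin n → ℝ))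
      (Set.finite_range _).bddAbove ⟨x, hx⟩

theorem multiMax_isGreatest (a : (Fin p → Fin n) → ℝ) :
    IsGreatest (tensorForm a '' {x | ∀ j, x j ∈ isingCube n})
      (multiMax (fun _ => isingCube n) a) := by
  have : Finite (isingCube n) := (isingCube_finite n).to_subtype
  have : Nonempty (isingCube n) := (isingCube_nonempty n).to_subtype
  constructor
  · obtain ⟨x, hx⟩ := exists_eq_ciSup_of_finite
      (f := fun x : Fin p → isingCube n => tensorForm a fun j => (x j : Fin n → ℝ))
    exact ⟨fun j => x j, fun j => (x j).2, hx⟩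
  · rintro _ ⟨x, hx, rfl⟩
    exact le_ciSup (f := fun x : Fin p → isingCube n => tensorForm a fun j => (x j : Fin n → ℝ))
      (Set.finite_range _).bddAbove fun j => ⟨x j, hx j⟩

/-- `ζ(p; S, n) = n^{-1/2} max_{x ∈ S} ∑ a_{i₁,…,i_p} ∏_j x_{i_j}`. -/
def zeta (S : Set (Fin n → ℝ)) (a : (Fin p → Fin n) → ℝ) : ℝ :=
  1 / Real.sqrt n * singleMax S a

/-- The function `c ↦ c²/2 + log erfc(-c√p/√2) - c u` that is minimized over `c > 0`. -/
def isingObjective (p : ℕ) (u c : ℝ) : ℝ :=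
  c ^ 2 / 2 + Real.log (erfc (-(c * Real.sqrt p) / Real.sqrt 2)) - c * u

/-- `c` minimizes `isingObjective p u` over the positive reals. -/
def IsIsingArgmin (p : ℕ) (u c : ℝ) : Prop :=
  0 < c ∧ IsMinOn (isingObjective p u) (Ioi 0) c

/-- The rate `φ(p,u)` in closed form, as a function of `u` and the minimizer `c = ĉ₃`. -/
def isingPhi (p : ℕ) (u c : ℝ) : ℝ :=
  -(c ^ 2 / 2) * ((p : ℝ) - 1) - Real.log (u - c) - c * u
    - 1 / 2 * Real.log (Real.pi / (2 * (p : ℝ)))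

/-- The set of all `u` for which the rate `φ(p,u)` is negative. -/
def negativeRateSet (p : ℕ) : Set ℝ :=
  {u | ∃ c, IsIsingArgmin p u c ∧ isingPhi p u c < 0}

/-- `u_GS^(sk)(p)`, the infimum of the `u` with `φ(p,u) < 0`. -/
def uGS (p : ℕ) : ℝ :=
  sInf (negativeRateSet p)

end PSpin

end

/-!
The whole result rests on one exponential moment bound. Over the Ising cube the tensor form
`G(x) = ∑ A_{i₁…i_p} ∏ x_{i_k}` is a centred Gaussian field with covariance `⟨x, y⟩ᵖ`. It is
compared with `Y(x) = √p ∑ₖ ηₖ xₖ`, whose covariance is `p ⟨x, y⟩`. The inequality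
`p t ≤ tᵖ + (p - 1)` on `[-1, 1]` says that the covariance of `Y` exceeds that of `G` by at most
`κ = p - 1`, with equality on the diagonal (`sum_add_one_le_prod_add_card`, in a form that also
covers the multipartite field, where `∑ tⱼ ≤ ∏ tⱼ + (p - 1)`).

For `0 ≤ s ≤ 1` the function `(∑ₓ e^{β yₓ})ˢ` has nonpositive mixed second derivatives. Rotating one
field into the other and integrating by parts therefore gives Kahane's inequality
`E (∑ e^{β Gₓ})ˢ · e^{(βs)² κ / 2} ≤ E (∑ e^{β Yₓ})ˢ` (`integral_partitionFn_rpow_mul_exp_le`). The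
constant `κ` is absorbed in the differential inequality, so no auxiliary Gaussian variable is
adjoined to `G`. With `l = βs` fixed and `s → 0` the soft maximum becomes the maximum
(`integral_exp_mul_selection_le`), and since `max Y` is at most a multiple of `∑ₖ |ηₖ|`, its
exponential moment factorizes into Gaussian integrals of `e^{C|x|}`, which are values of `erfc`. The
outcome is `E e^{c √n max G} ≤ e^{n (c²/2 + log erfc (-c√p/√2))}` for every `n ≥ 1` and `c > 0`
(`integral_exp_singleMax_le`), and similarly for the multipartite field.

Chernoff's bound then gives the large deviation estimate, and Jensen's inequality bounds the mean of
the maximum by `√n (c/2 + (1/c) log erfc (-c√p/√2))`. The objective of the minimization equals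
`c (h(c) - u)` with `h = groundStateBound p` this last ratio, so the rate is negative exactly for
`u > min h`. The minimum of `h` is attained: `h → ∞` at infinity, and near `0` it falls below its
limit because `1 - 2p/π < 0`, which is where `p ≥ 2` enters (`exists_groundStateBound_lt`).
-/

noncomputable section

namespace PSpin

/-! ### Integration against standard Gaussian vectors -/

section Gaussian

/-- The law of a vector of independent standard normal variables indexed by `K`. -/
def stdGaussianPi (K : Type*) [Fintype K] : Measure (K → ℝ) :=
  Measure.pi fun _ => gaussianReal 0 1

instance isProbabilityMeasure_stdGaussianPi (K : Type*) [Fintype K] :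
    IsProbabilityMeasure (stdGaussianPi K) := by
  unfold stdGaussianPi; infer_instance

theorem hasDerivAt_gaussianPDFReal_std (x : ℝ) :
    HasDerivAt (gaussianPDFReal 0 1) (-x * gaussianPDFReal 0 1 x) x := by
  have h : HasDerivAt (fun x : ℝ => -(x - 0) ^ 2 / (2 * ((1 : NNReal) : ℝ))) (-x) x := by
    have := ((((hasDerivAt_id x).sub_const 0).pow 2).neg).div_const (2 * ((1 : NNReal) : ℝ))
    refine this.congr_deriv ?_
    simp only [id, NNReal.coe_one]
    ring
  have := (h.exp).const_mul (√(2 * Real.pi * ((1 : NNReal) : ℝ)))⁻¹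
  refine this.congr_deriv ?_
  simp only [gaussianPDFReal]
  ring

theorem integrable_gaussianReal_iff {f : ℝ → ℝ} :
    Integrable f (gaussianReal 0 1) ↔ Integrable fun x => gaussianPDFReal 0 1 x * f x := by
  rw [gaussianReal_of_var_ne_zero 0 one_ne_zero,
    integrable_withDensity_iff_integrable_smul' (measurable_gaussianPDF 0 1)
      (ae_of_all _ fun _ => gaussianPDF_lt_top)]
  simp only [toReal_gaussianPDF, smul_eq_mul]

/-- Gaussian integration by parts (Stein's identity) on the line. -/
theorem integral_id_mul_gaussianReal {f f' : ℝ → ℝ} (hf : ∀ x, HasDerivAt f (f' x) x)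
    (h0 : Integrable f (gaussianReal 0 1)) (h1 : Integrable f' (gaussianReal 0 1))
    (h2 : Integrable (fun x => x * f x) (gaussianReal 0 1)) :
    ∫ x, x * f x ∂(gaussianReal 0 1) = ∫ x, f' x ∂(gaussianReal 0 1) := by
  rw [integrable_gaussianReal_iff] at h0 h1 h2
  rw [integral_gaussianReal_eq_integral_smul one_ne_zero,
    integral_gaussianReal_eq_integral_smul one_ne_zero]
  have := integral_mul_deriv_eq_deriv_mul_of_integrable (u := gaussianPDFReal 0 1) (v := f)
    (u' := fun x => -x * gaussianPDFReal 0 1 x) (v' := f')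
    (fun x _ => hasDerivAt_gaussianPDFReal_std x) (fun x _ => hf x) h1
    (h2.neg.congr (ae_of_all _ fun x => by simp; ring)) h0
  simp only [smul_eq_mul]
  rw [this, ← integral_neg]
  congr 1 with x
  ring

variable {K : Type*} [Fintype K]

/-- Resampling one coordinate preserves the law of a standard Gaussian vector. -/
theorem measurePreserving_update_stdGaussianPi [DecidableEq K] (k : K) :
    MeasurePreserving (fun z : (K → ℝ) × ℝ => Function.update z.1 k z.2)
      ((stdGaussianPi K).prod (gaussianReal 0 1)) (stdGaussianPi K) := by
  have hm : Measurable (fun z : (K → ℝ) × ℝ => Function.update z.1 k z.2) := by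
    refine measurable_pi_lambda _ fun j => ?_
    by_cases h : j = k
    · subst h; simpa using measurable_snd
    · simpa [h, Function.comp_def] using (measurable_pi_apply j).comp measurable_fst
  refine ⟨hm, ?_⟩
  unfold stdGaussianPi
  refine (Measure.pi_eq fun s hs => ?_).symm
  rw [Measure.map_apply hm (MeasurableSet.univ_pi hs)]
  have : (fun z : (K → ℝ) × ℝ => Function.update z.1 k z.2) ⁻¹' univ.pi s
      = (univ.pi (Function.update s k univ)) ×ˢ s k := by
    ext z
    simp only [mem_preimage, Set.mem_pi, mem_univ, true_imp_iff, mem_prod]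
    constructor
    · intro h
      refine ⟨fun j => ?_, by simpa using h k⟩
      by_cases hj : j = k
      · subst hj; simp
      · simpa [hj] using h j
    · rintro ⟨h, h'⟩ j
      by_cases hj : j = k
      · subst hj; simpa using h'
      · simpa [hj] using h j
  rw [this, Measure.prod_prod, Measure.pi_pi, ← Finset.mul_prod_erase _ _ (Finset.mem_univ k),
    ← Finset.mul_prod_erase _ (fun i => gaussianReal 0 1 (s i)) (Finset.mem_univ k)]
  simp only [Function.update_self, measure_univ, one_mul]
  rw [mul_comm]
  congr 1
  refine Finset.prod_congr rfl fun j hj => ?_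
  rw [Function.update_of_ne (Finset.ne_of_mem_erase hj)]

/-- Gaussian integration by parts in the coordinate `k` of a standard Gaussian vector. -/
theorem integral_apply_mul_stdGaussianPi [DecidableEq K] (k : K) {f f' : (K → ℝ) → ℝ}
    (hf : ∀ ξ t, HasDerivAt (fun t => f (Function.update ξ k t)) (f' (Function.update ξ k t)) t)
    (h0 : Integrable f (stdGaussianPi K)) (h1 : Integrable f' (stdGaussianPi K))
    (h2 : Integrable (fun ξ => ξ k * f ξ) (stdGaussianPi K)) :
    ∫ ξ, ξ k * f ξ ∂(stdGaussianPi K) = ∫ ξ, f' ξ ∂(stdGaussianPi K) := by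
  have hmp := measurePreserving_update_stdGaussianPi k
  have key : ∀ g : (K → ℝ) → ℝ, Integrable g (stdGaussianPi K) →
      Integrable (fun z : (K → ℝ) × ℝ => g (Function.update z.1 k z.2))
        ((stdGaussianPi K).prod (gaussianReal 0 1)) ∧
      ∫ ξ, g ξ ∂(stdGaussianPi K)
        = ∫ ξ, ∫ t, g (Function.update ξ k t) ∂(gaussianReal 0 1) ∂(stdGaussianPi K) := by
    intro g hg
    have hi : Integrable (fun z : (K → ℝ) × ℝ => g (Function.update z.1 k z.2))
        ((stdGaussianPi K).prod (gaussianReal 0 1)) :=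
      (hmp.integrable_comp hg.aestronglyMeasurable).2 hg
    refine ⟨hi, ?_⟩
    rw [← integral_prod _ hi]
    conv_lhs => rw [← hmp.map_eq]
    rw [integral_map hmp.measurable.aemeasurable]
    rw [hmp.map_eq]; exact hg.aestronglyMeasurable
  obtain ⟨i0, -⟩ := key _ h0
  obtain ⟨i1, e1⟩ := key _ h1
  obtain ⟨i2, e2⟩ := key _ h2
  rw [e1, e2]
  refine integral_congr_ae ?_
  filter_upwards [i0.prod_right_ae, i1.prod_right_ae, i2.prod_right_ae] with ξ j0 j1 j2
  simp only [Function.update_self] at j2 ⊢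
  exact integral_id_mul_gaussianReal (hf ξ) j0 j1 j2

theorem integrable_exp_mul_abs_gaussianReal (C : ℝ) :
    Integrable (fun x => Real.exp (C * |x|)) (gaussianReal 0 1) :=
  integrable_exp_mul_abs (integrable_exp_mul_gaussianReal C) (integrable_exp_mul_gaussianReal (-C))

theorem integrable_exp_mul_sum_abs (C : ℝ) :
    Integrable (fun ξ : K → ℝ => Real.exp (C * ∑ k, |ξ k|)) (stdGaussianPi K) := by
  simp_rw [Finset.mul_sum, Real.exp_sum]
  exact Integrable.fintype_prod (f := fun _ x => Real.exp (C * |x|))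
    fun _ => integrable_exp_mul_abs_gaussianReal C

theorem integral_exp_mul_sum_abs (C : ℝ) :
    ∫ ξ : K → ℝ, Real.exp (C * ∑ k, |ξ k|) ∂(stdGaussianPi K)
      = (∫ x, Real.exp (C * |x|) ∂(gaussianReal 0 1)) ^ Fintype.card K := by
  simp_rw [Finset.mul_sum, Real.exp_sum]
  exact integral_fintype_prod_eq_pow (ι := K) fun x => Real.exp (C * |x|)

/-- Measurable functions of at most exponential growth are integrable. -/
theorem integrable_stdGaussianPi_of_le {f : (K → ℝ) → ℝ} (hf : Measurable f) (B C : ℝ)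
    (h : ∀ ξ, |f ξ| ≤ B * Real.exp (C * ∑ k, |ξ k|)) : Integrable f (stdGaussianPi K) :=
  ((integrable_exp_mul_sum_abs C).const_mul B).mono' hf.aestronglyMeasurable
    (ae_of_all _ h)

theorem abs_apply_le_exp_sum_abs (ξ : K → ℝ) (k : K) : |ξ k| ≤ Real.exp (∑ k, |ξ k|) :=
  (Finset.single_le_sum (f := fun k => |ξ k|) (fun _ _ => abs_nonneg _)
    (Finset.mem_univ k)).trans ((lt_add_one _).le.trans (Real.add_one_le_exp _))

/-- A sub-vector of a standard Gaussian vector is a standard Gaussian vector. -/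
theorem measurePreserving_comp_inl (I J : Type*) [Fintype I] [Fintype J] :
    MeasurePreserving (fun ξ : I ⊕ J → ℝ => fun i => ξ (Sum.inl i))
      (stdGaussianPi (I ⊕ J)) (stdGaussianPi I) := by
  have h := measurePreserving_sumPiEquivProdPi (X := fun _ : I ⊕ J => ℝ)
    (fun _ => gaussianReal 0 1)
  exact (measurePreserving_fst (μ := stdGaussianPi I) (ν := stdGaussianPi J)).comp h

theorem measurePreserving_comp_inr (I J : Type*) [Fintype I] [Fintype J] :
    MeasurePreserving (fun ξ : I ⊕ J → ℝ => fun j => ξ (Sum.inr j))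
      (stdGaussianPi (I ⊕ J)) (stdGaussianPi J) := by
  have h := measurePreserving_sumPiEquivProdPi (X := fun _ : I ⊕ J => ℝ)
    (fun _ => gaussianReal 0 1)
  exact (measurePreserving_snd (μ := stdGaussianPi I) (ν := stdGaussianPi J)).comp h

end Gaussian

/-! ### Powers of the partition function -/

section SoftMax

variable {T : Type*} [Fintype T]

/-- The partition function `∑ₓ e^{β yₓ}` at inverse temperature `β`. -/
def partitionFn (β : ℝ) (y : T → ℝ) : ℝ :=
  ∑ x, Real.exp (β * y x)

theorem partitionFn_pos [Nonempty T] (β : ℝ) (y : T → ℝ) : 0 < partitionFn β y :=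
  Finset.sum_pos (fun _ _ => Real.exp_pos _) Finset.univ_nonempty

theorem exp_le_partitionFn (β : ℝ) (y : T → ℝ) (x : T) :
    Real.exp (β * y x) ≤ partitionFn β y :=
  Finset.single_le_sum (f := fun x => Real.exp (β * y x)) (fun _ _ => (Real.exp_pos _).le)
    (Finset.mem_univ x)

theorem continuous_partitionFn (β : ℝ) : Continuous (partitionFn (T := T) β) := by
  unfold partitionFn; fun_prop

theorem continuous_partitionFn_rpow [Nonempty T] (β s : ℝ) :
    Continuous fun y : T → ℝ => partitionFn β y ^ s :=
  (continuous_partitionFn β).rpow_const fun y => Or.inl (partitionFn_pos β y).ne'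

theorem hasDerivAt_partitionFn (β : ℝ) {y : ℝ → T → ℝ} {d : T → ℝ} {t : ℝ}
    (hy : ∀ x, HasDerivAt (fun t => y t x) (d x) t) :
    HasDerivAt (fun t => partitionFn β (y t)) (β * ∑ x, d x * Real.exp (β * y t x)) t := by
  unfold partitionFn
  refine (HasDerivAt.fun_sum fun x _ => ((hy x).const_mul β).exp).congr_deriv ?_
  rw [Finset.mul_sum]
  exact Finset.sum_congr rfl fun x _ => by ring

/-- For exponents in `[0, 1]` a power of the partition function is bounded by an exponential. -/
theorem partitionFn_rpow_le {β s L : ℝ} (hβ : 0 ≤ β) (hs0 : 0 ≤ s) (hs1 : s ≤ 1) [Nonempty T]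
    {y : T → ℝ} (hy : ∀ x, |y x| ≤ L) :
    partitionFn β y ^ s ≤ (1 + Fintype.card T) * Real.exp (β * L) := by
  have hL : 0 ≤ L := (abs_nonneg _).trans (hy (Classical.arbitrary T))
  have hZ := partitionFn_pos β y
  have h1 : partitionFn β y ≤ Fintype.card T * Real.exp (β * L) := by
    unfold partitionFn
    refine (Finset.sum_le_card_nsmul _ _ (Real.exp (β * L)) fun x _ => ?_).trans (by simp)
    exact Real.exp_le_exp.2 (mul_le_mul_of_nonneg_left ((le_abs_self _).trans (hy x)) hβ)
  have h2 : (1 : ℝ) ≤ Real.exp (β * L) := Real.one_le_exp (by positivity)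
  have h3 : partitionFn β y ^ s ≤ 1 + partitionFn β y := by
    rcases le_total (partitionFn β y) 1 with h | h
    · linarith [Real.rpow_le_one hZ.le h hs0]
    · calc _ ≤ partitionFn β y ^ (1 : ℝ) := Real.rpow_le_rpow_of_exponent_le h hs1
        _ ≤ _ := by rw [Real.rpow_one]; linarith
  linarith

/-- Up to the factor `βs`, the partial derivative of `(∑ e^{βy})^s` in the coordinate `x`. -/
def gibbsWeight (β s : ℝ) (x : T) (y : T → ℝ) : ℝ :=
  Real.exp (β * y x) * partitionFn β y ^ (s - 1)

/-- The off-diagonal part of the second derivatives of `(∑ e^{βy})^s`, up to `β²s(s - 1)`. -/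
def gibbsPairWeight (β s : ℝ) (x x' : T) (y : T → ℝ) : ℝ :=
  Real.exp (β * y x) * Real.exp (β * y x') * partitionFn β y ^ (s - 2)

variable [Nonempty T]

theorem sum_gibbsWeight (β s : ℝ) (y : T → ℝ) :
    ∑ x, gibbsWeight β s x y = partitionFn β y ^ s := by
  unfold gibbsWeight
  rw [← Finset.sum_mul]
  change partitionFn β y * _ = _
  nth_rewrite 1 [← Real.rpow_one (partitionFn β y)]
  rw [← Real.rpow_add (partitionFn_pos β y), add_sub_cancel]

theorem gibbsWeight_pos (β s : ℝ) (x : T) (y : T → ℝ) : 0 < gibbsWeight β s x y :=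
  mul_pos (Real.exp_pos _) (Real.rpow_pos_of_pos (partitionFn_pos β y) _)

theorem gibbsPairWeight_pos (β s : ℝ) (x x' : T) (y : T → ℝ) : 0 < gibbsPairWeight β s x x' y :=
  mul_pos (mul_pos (Real.exp_pos _) (Real.exp_pos _))
    (Real.rpow_pos_of_pos (partitionFn_pos β y) _)

theorem sum_gibbsPairWeight (β s : ℝ) (x : T) (y : T → ℝ) :
    ∑ x', gibbsPairWeight β s x x' y = gibbsWeight β s x y := by
  unfold gibbsPairWeight gibbsWeight
  have hZ := partitionFn_pos β y
  simp_rw [mul_assoc]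
  rw [← Finset.mul_sum, ← Finset.sum_mul]
  change _ * (partitionFn β y * _) = _
  rw [show s - 1 = 1 + (s - 2) by ring, Real.rpow_add hZ, Real.rpow_one]

theorem gibbsWeight_le (β s : ℝ) (x : T) (y : T → ℝ) :
    gibbsWeight β s x y ≤ partitionFn β y ^ s := by
  rw [← sum_gibbsWeight]
  exact Finset.single_le_sum (f := fun x => gibbsWeight β s x y)
    (fun x _ => (gibbsWeight_pos β s x y).le) (Finset.mem_univ x)

theorem gibbsPairWeight_le (β s : ℝ) (x x' : T) (y : T → ℝ) :
    gibbsPairWeight β s x x' y ≤ partitionFn β y ^ s := by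
  refine le_trans ?_ (gibbsWeight_le β s x y)
  rw [← sum_gibbsPairWeight]
  exact Finset.single_le_sum (f := fun x' => gibbsPairWeight β s x x' y)
    (fun x' _ => (gibbsPairWeight_pos β s x x' y).le) (Finset.mem_univ x')

theorem continuous_gibbsWeight (β s : ℝ) (x : T) : Continuous (gibbsWeight β s x) := by
  unfold gibbsWeight
  exact (by fun_prop : Continuous fun y : T → ℝ => Real.exp (β * y x)).mul
    (continuous_partitionFn_rpow β _)

theorem continuous_gibbsPairWeight (β s : ℝ) (x x' : T) :
    Continuous (gibbsPairWeight β s x x') := by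
  unfold gibbsPairWeight
  exact (by fun_prop : Continuous fun y : T → ℝ => Real.exp (β * y x) * Real.exp (β * y x')).mul
    (continuous_partitionFn_rpow β _)

theorem hasDerivAt_partitionFn_rpow (β s : ℝ) {y : ℝ → T → ℝ} {d : T → ℝ} {t : ℝ}
    (hy : ∀ x, HasDerivAt (fun t => y t x) (d x) t) :
    HasDerivAt (fun t => partitionFn β (y t) ^ s)
      (β * s * ∑ x, d x * gibbsWeight β s x (y t)) t := by
  refine ((hasDerivAt_partitionFn β hy).rpow_const
    (Or.inl (partitionFn_pos β (y t)).ne')).congr_deriv ?_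
  simp only [gibbsWeight, Finset.mul_sum, Finset.sum_mul]
  exact Finset.sum_congr rfl fun x _ => by ring

theorem hasDerivAt_gibbsWeight (β s : ℝ) (x : T) {y : ℝ → T → ℝ} {d : T → ℝ} {t : ℝ}
    (hy : ∀ x, HasDerivAt (fun t => y t x) (d x) t) :
    HasDerivAt (fun t => gibbsWeight β s x (y t))
      (β * (d x * gibbsWeight β s x (y t)
        + (s - 1) * ∑ x', d x' * gibbsPairWeight β s x x' (y t))) t := by
  refine ((((hy x).const_mul β).exp).mul ((hasDerivAt_partitionFn β hy).rpow_const (p := s - 1)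
    (Or.inl (partitionFn_pos β (y t)).ne'))).congr_deriv ?_
  simp only [gibbsWeight, gibbsPairWeight, Finset.mul_sum, Finset.sum_mul, mul_add,
    show s - 1 - 1 = s - 2 by ring]
  congr 1
  · ring
  · exact Finset.sum_congr rfl fun x _ => by ring

end SoftMax

/-! ### Kahane's comparison inequality -/

section Comparison

variable {T K : Type*} [Fintype K]

/-- The Gaussian field `x ↦ ∑ₖ mₓₖ ξₖ` on the index set `T`, driven by the vector `ξ`. -/
def linField (m : T → K → ℝ) (ξ : K → ℝ) (x : T) : ℝ :=
  ∑ k, m x k * ξ k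

theorem continuous_linField (m : T → K → ℝ) : Continuous (linField m) := by
  unfold linField; fun_prop

theorem abs_linField_le {m : T → K → ℝ} {M : ℝ} (hm : ∀ x k, |m x k| ≤ M) (ξ : K → ℝ) (x : T) :
    |linField m ξ x| ≤ M * ∑ k, |ξ k| := by
  unfold linField
  rw [Finset.mul_sum]
  refine (Finset.abs_sum_le_sum_abs _ _).trans (Finset.sum_le_sum fun k _ => ?_)
  rw [abs_mul]
  exact mul_le_mul_of_nonneg_right (hm x k) (abs_nonneg _)

theorem hasDerivAt_linField_update [DecidableEq K] (m : T → K → ℝ) (ξ : K → ℝ) (k : K) (x : T)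
    (t : ℝ) : HasDerivAt (fun t => linField m (Function.update ξ k t) x) (m x k) t := by
  unfold linField
  have h := HasDerivAt.fun_sum (u := Finset.univ) fun j _ =>
    ((hasDerivAt_pi.1 (hasDerivAt_update ξ k t)) j).const_mul (m x j)
  refine h.congr_deriv ?_
  simp [Pi.single_apply]

variable [Fintype T] [Nonempty T]

theorem partitionFn_linField_rpow_le {β s M : ℝ} (hβ : 0 ≤ β) (hs0 : 0 ≤ s) (hs1 : s ≤ 1)
    {m : T → K → ℝ} (hm : ∀ x k, |m x k| ≤ M) (ξ : K → ℝ) :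
    partitionFn β (linField m ξ) ^ s
      ≤ (1 + Fintype.card T) * Real.exp (β * M * ∑ k, |ξ k|) := by
  rw [mul_assoc]
  exact partitionFn_rpow_le hβ hs0 hs1 (abs_linField_le hm ξ)

omit [Nonempty T] in
theorem exists_abs_le (m : T → K → ℝ) : ∃ M, 0 ≤ M ∧ ∀ x k, |m x k| ≤ M := by
  refine ⟨∑ x, ∑ k, |m x k|, by positivity, fun x k => ?_⟩
  exact (Finset.single_le_sum (f := fun k => |m x k|) (fun _ _ => abs_nonneg _)
    (Finset.mem_univ k)).trans (Finset.single_le_sum (f := fun x => ∑ k, |m x k|)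
      (fun _ _ => Finset.sum_nonneg fun _ _ => abs_nonneg _) (Finset.mem_univ x))

section Integrability

variable {β s : ℝ} (hβ : 0 ≤ β) (hs0 : 0 ≤ s) (hs1 : s ≤ 1) (m : T → K → ℝ)
include hβ hs0 hs1

theorem integrable_partitionFn_rpow :
    Integrable (fun ξ => partitionFn β (linField m ξ) ^ s) (stdGaussianPi K) := by
  obtain ⟨M, -, hM⟩ := exists_abs_le m
  refine integrable_stdGaussianPi_of_le
    ((continuous_partitionFn_rpow β s).comp (continuous_linField m)).measurable
    (1 + Fintype.card T) (β * M)
    fun ξ => ?_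
  rw [abs_of_nonneg (Real.rpow_nonneg (partitionFn_pos _ _).le _)]
  exact partitionFn_linField_rpow_le hβ hs0 hs1 hM ξ

theorem integrable_gibbsWeight (x : T) :
    Integrable (fun ξ => gibbsWeight β s x (linField m ξ)) (stdGaussianPi K) := by
  refine (integrable_partitionFn_rpow hβ hs0 hs1 m).mono'
    ((continuous_gibbsWeight β s x).comp (continuous_linField m)).aestronglyMeasurable
    (ae_of_all _ fun ξ => ?_)
  rw [Real.norm_of_nonneg (gibbsWeight_pos β s x _).le]
  exact gibbsWeight_le β s x _

theorem integrable_gibbsPairWeight (x x' : T) :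
    Integrable (fun ξ => gibbsPairWeight β s x x' (linField m ξ)) (stdGaussianPi K) := by
  refine (integrable_partitionFn_rpow hβ hs0 hs1 m).mono'
    ((continuous_gibbsPairWeight β s x x').comp (continuous_linField m)).aestronglyMeasurable
    (ae_of_all _ fun ξ => ?_)
  rw [Real.norm_of_nonneg (gibbsPairWeight_pos β s x x' _).le]
  exact gibbsPairWeight_le β s x x' _

theorem integrable_apply_mul_gibbsWeight (k : K) (x : T) :
    Integrable (fun ξ => ξ k * gibbsWeight β s x (linField m ξ)) (stdGaussianPi K) := by
  obtain ⟨M, -, hM⟩ := exists_abs_le m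
  refine integrable_stdGaussianPi_of_le ((continuous_apply k).mul
    ((continuous_gibbsWeight β s x).comp (continuous_linField m))).measurable
    (1 + Fintype.card T) (1 + β * M) fun ξ => ?_
  rw [abs_mul, abs_of_pos (gibbsWeight_pos β s x _), add_mul 1 (β * M), Real.exp_add, one_mul]
  refine (mul_le_mul (abs_apply_le_exp_sum_abs ξ k) ((gibbsWeight_le β s x _).trans
    (partitionFn_linField_rpow_le hβ hs0 hs1 hM ξ)) (gibbsWeight_pos β s x _).le
    (Real.exp_pos _).le).trans (le_of_eq (by ring))

theorem integral_apply_mul_gibbsWeight (k : K) (x : T) :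
    ∫ ξ, ξ k * gibbsWeight β s x (linField m ξ) ∂(stdGaussianPi K)
      = β * (m x k * ∫ ξ, gibbsWeight β s x (linField m ξ) ∂(stdGaussianPi K)
        + (s - 1) * ∑ x', m x' k *
          ∫ ξ, gibbsPairWeight β s x x' (linField m ξ) ∂(stdGaussianPi K)) := by
  classical
  have i1 := (integrable_gibbsWeight hβ hs0 hs1 m x).const_mul (m x k)
  have i2 : ∀ x' ∈ Finset.univ, Integrable (fun ξ => m x' k *
      gibbsPairWeight β s x x' (linField m ξ)) (stdGaussianPi K) := fun x' _ =>
    (integrable_gibbsPairWeight hβ hs0 hs1 m x x').const_mul (m x' k)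
  have i3 := (integrable_finsetSum _ i2).const_mul (s - 1)
  rw [integral_apply_mul_stdGaussianPi k (f := fun ξ => gibbsWeight β s x (linField m ξ))
    (fun ξ t => hasDerivAt_gibbsWeight β s x
      (y := fun t => linField m (Function.update ξ k t)) (d := fun x => m x k)
      fun x => hasDerivAt_linField_update m ξ k x t)
    (integrable_gibbsWeight hβ hs0 hs1 m x) ((i1.add i3).const_mul β)
    (integrable_apply_mul_gibbsWeight hβ hs0 hs1 m k x)]
  rw [integral_const_mul, integral_add' i1 i3, integral_const_mul, integral_const_mul,
    integral_finsetSum _ i2]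
  simp only [integral_const_mul]

end Integrability

/-- The coefficients of the field interpolating between `a` (at `θ = 0`) and `b`
(at `θ = π / 2`). -/
def rotate (a b : T → K → ℝ) (θ : ℝ) : T → K → ℝ :=
  fun x k => Real.cos θ * a x k + Real.sin θ * b x k

/-- The derivative in `θ` of `rotate a b θ`. -/
def rotateDeriv (a b : T → K → ℝ) (θ : ℝ) : T → K → ℝ :=
  fun x k => -Real.sin θ * a x k + Real.cos θ * b x k

omit [Fintype T] [Nonempty T] in
theorem hasDerivAt_linField_rotate (a b : T → K → ℝ) (ξ : K → ℝ) (x : T) (θ : ℝ) :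
    HasDerivAt (fun θ => linField (rotate a b θ) ξ x) (linField (rotateDeriv a b θ) ξ x) θ := by
  unfold linField rotate rotateDeriv
  exact HasDerivAt.fun_sum fun k _ => (((Real.hasDerivAt_cos θ).mul_const (a x k)).add
    ((Real.hasDerivAt_sin θ).mul_const (b x k))).mul_const (ξ k)

/-- The derivative of the expected power of the partition function along the interpolation,
before integration by parts. -/
theorem hasDerivAt_integral_partitionFn_rotate {β s : ℝ} (hβ : 0 ≤ β) (hs0 : 0 ≤ s) (hs1 : s ≤ 1)
    (a b : T → K → ℝ) (θ : ℝ) :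
    HasDerivAt (fun θ => ∫ ξ, partitionFn β (linField (rotate a b θ) ξ) ^ s ∂(stdGaussianPi K))
      (∫ ξ, β * s * ∑ x, linField (rotateDeriv a b θ) ξ x *
        gibbsWeight β s x (linField (rotate a b θ) ξ) ∂(stdGaussianPi K)) θ := by
  obtain ⟨A, hA0, hA⟩ := exists_abs_le a
  obtain ⟨B, hB0, hB⟩ := exists_abs_le b
  have hr : ∀ θ x k, |rotate a b θ x k| ≤ A + B := fun θ x k => by
    refine (abs_add_le _ _).trans (add_le_add ?_ ?_)
    · rw [abs_mul]
      exact (mul_le_of_le_one_left (abs_nonneg _) (Real.abs_cos_le_one θ)).trans (hA x k)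
    · rw [abs_mul]
      exact (mul_le_of_le_one_left (abs_nonneg _) (Real.abs_sin_le_one θ)).trans (hB x k)
  have hr' : ∀ θ x k, |rotateDeriv a b θ x k| ≤ A + B := fun θ x k => by
    refine (abs_add_le _ _).trans (add_le_add ?_ ?_)
    · rw [abs_mul, abs_neg]
      exact (mul_le_of_le_one_left (abs_nonneg _) (Real.abs_sin_le_one θ)).trans (hA x k)
    · rw [abs_mul]
      exact (mul_le_of_le_one_left (abs_nonneg _) (Real.abs_cos_le_one θ)).trans (hB x k)
  refine (hasDerivAt_integral_of_dominated_loc_of_deriv_le (s := univ)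
    (F := fun θ ξ => partitionFn β (linField (rotate a b θ) ξ) ^ s)
    (F' := fun θ ξ => β * s * ∑ x, linField (rotateDeriv a b θ) ξ x *
        gibbsWeight β s x (linField (rotate a b θ) ξ))
    (bound := fun ξ => β * s * (Fintype.card T * ((A + B) * (1 + Fintype.card T))) *
      Real.exp ((1 + β * (A + B)) * ∑ k, |ξ k|))
    univ_mem
    (Eventually.of_forall fun θ => ((continuous_partitionFn_rpow β s).comp
      (continuous_linField _)).aestronglyMeasurable)
    (integrable_partitionFn_rpow hβ hs0 hs1 _) ?_ (ae_of_all _ fun ξ θ _ => ?_)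
    ((integrable_exp_mul_sum_abs _).const_mul _) (ae_of_all _ fun ξ θ _ => ?_)).2
  · refine Continuous.aestronglyMeasurable (continuous_const.mul (continuous_finsetSum _
      fun x _ => ?_))
    exact ((continuous_apply x).comp (continuous_linField _)).mul
      ((continuous_gibbsWeight β s x).comp (continuous_linField _))
  · rw [norm_mul, Real.norm_of_nonneg (mul_nonneg hβ hs0), mul_assoc (β * s)]
    refine mul_le_mul_of_nonneg_left ?_ (mul_nonneg hβ hs0)
    refine (norm_sum_le _ _).trans ((Finset.sum_le_card_nsmul _ _ ((A + B) *
      (1 + Fintype.card T) * Real.exp ((1 + β * (A + B)) * ∑ k, |ξ k|))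
      fun x _ => ?_).trans (le_of_eq ?_))
    · rw [norm_mul, Real.norm_of_nonneg (gibbsWeight_pos β s x _).le, add_mul 1 (β * (A + B)),
        Real.exp_add, one_mul]
      have h1 : |linField (rotateDeriv a b θ) ξ x| ≤ (A + B) * Real.exp (∑ k, |ξ k|) :=
        (abs_linField_le (hr' θ) ξ x).trans (mul_le_mul_of_nonneg_left
          ((lt_add_one _).le.trans (Real.add_one_le_exp _)) (by positivity))
      refine (mul_le_mul h1 ((gibbsWeight_le β s x _).trans
        (partitionFn_linField_rpow_le hβ hs0 hs1 (hr θ) ξ)) (gibbsWeight_pos β s x _).le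
        (by positivity)).trans (le_of_eq (by ring))
    · simp only [Finset.card_univ, nsmul_eq_mul]; ring
  · exact hasDerivAt_partitionFn_rpow β s (y := fun θ => linField (rotate a b θ) ξ)
      fun x => hasDerivAt_linField_rotate a b ξ x θ

/-- If the covariances of the two fields differ by the constant `κ` on the diagonal and by at most
`κ` elsewhere, the logarithmic derivative along the interpolation is at least that of
`exp ((β s)² κ sin² θ / 2)`. -/
theorem le_integral_deriv_partitionFn_rotate {β s κ : ℝ} (hβ : 0 ≤ β) (hs0 : 0 ≤ s) (hs1 : s ≤ 1)
    {a b : T → K → ℝ} (hab : ∀ x y, ∑ k, a x k * b y k = 0)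
    (hdiag : ∀ x, ∑ k, b x k * b x k = ∑ k, a x k * a x k + κ)
    (hle : ∀ x y, ∑ k, b x k * b y k ≤ ∑ k, a x k * a y k + κ)
    {θ : ℝ} (hsin : 0 ≤ Real.sin θ) (hcos : 0 ≤ Real.cos θ) :
    (β * s) ^ 2 * κ * (Real.sin θ * Real.cos θ) *
        ∫ ξ, partitionFn β (linField (rotate a b θ) ξ) ^ s ∂(stdGaussianPi K)
      ≤ ∫ ξ, β * s * ∑ x, linField (rotateDeriv a b θ) ξ x *
        gibbsWeight β s x (linField (rotate a b θ) ξ) ∂(stdGaussianPi K) := by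
  set m := rotate a b θ with hm
  set m' := rotateDeriv a b θ with hm'
  set g : T → ℝ := fun x => ∫ ξ, gibbsWeight β s x (linField m ξ) ∂(stdGaussianPi K) with hg
  set q : T → T → ℝ := fun x x' =>
    ∫ ξ, gibbsPairWeight β s x x' (linField m ξ) ∂(stdGaussianPi K) with hq
  set F := ∫ ξ, partitionFn β (linField m ξ) ^ s ∂(stdGaussianPi K) with hF
  have hgF : ∑ x, g x = F := by
    rw [hg, hF, ← integral_finsetSum _ fun x _ => integrable_gibbsWeight hβ hs0 hs1 m x]
    simp_rw [sum_gibbsWeight]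
  have hqg : ∀ x, ∑ x', q x x' = g x := fun x => by
    simp only [hq, hg]
    rw [← integral_finsetSum _ fun x' _ => integrable_gibbsPairWeight hβ hs0 hs1 m x x']
    simp_rw [sum_gibbsPairWeight]
  have hq0 : ∀ x x', 0 ≤ q x x' := fun x x' =>
    integral_nonneg fun ξ => (gibbsPairWeight_pos β s x x' _).le
  have hC : ∀ x y, ∑ k, m' x k * m y k = Real.sin θ * Real.cos θ *
      (∑ k, b x k * b y k - ∑ k, a x k * a y k) := fun x y => by
    have h1 := hab x y
    have h2 := hab y x
    have : ∑ k, m' x k * m y k = Real.sin θ * Real.cos θ * ∑ k, b x k * b y k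
        - Real.sin θ * Real.cos θ * ∑ k, a x k * a y k - Real.sin θ ^ 2 * ∑ k, a x k * b y k
        + Real.cos θ ^ 2 * ∑ k, a y k * b x k := by
      simp only [Finset.mul_sum, ← Finset.sum_sub_distrib, ← Finset.sum_add_distrib]
      refine Finset.sum_congr rfl fun k _ => ?_
      simp only [hm, hm', rotate, rotateDeriv]
      ring
    rw [this, h1, h2]; ring
  have hint : ∫ ξ, β * s * ∑ x, linField m' ξ x * gibbsWeight β s x (linField m ξ)
        ∂(stdGaussianPi K)
      = β * s * ∑ x, ∑ k, m' x k * (β * (m x k * g x + (s - 1) * ∑ x', m x' k * q x x')) := by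
    have i : ∀ x k, Integrable (fun ξ => m' x k * (ξ k * gibbsWeight β s x (linField m ξ)))
        (stdGaussianPi K) := fun x k =>
      (integrable_apply_mul_gibbsWeight hβ hs0 hs1 m k x).const_mul _
    rw [integral_const_mul]
    congr 1
    have : ∀ ξ : K → ℝ, ∑ x, linField m' ξ x * gibbsWeight β s x (linField m ξ)
        = ∑ x, ∑ k, m' x k * (ξ k * gibbsWeight β s x (linField m ξ)) := fun ξ => by
      refine Finset.sum_congr rfl fun x _ => ?_
      rw [show linField m' ξ x = ∑ k, m' x k * ξ k from rfl, Finset.sum_mul]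
      exact Finset.sum_congr rfl fun k _ => by ring
    simp_rw [this]
    rw [integral_finsetSum _ fun x _ => integrable_finsetSum _ fun k _ => i x k]
    refine Finset.sum_congr rfl fun x _ => ?_
    rw [integral_finsetSum _ fun k _ => i x k]
    refine Finset.sum_congr rfl fun k _ => ?_
    rw [integral_const_mul, integral_apply_mul_gibbsWeight hβ hs0 hs1 m k x]
  have hsum : ∀ x, ∑ k, m' x k * (β * (m x k * g x + (s - 1) * ∑ x', m x' k * q x x'))
      = β * (Real.sin θ * Real.cos θ * κ * g x + (s - 1) * ∑ x', (∑ k, m' x k * m x' k) * q x x') :=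
    fun x => by
    have hxx : Real.sin θ * Real.cos θ * κ = ∑ k, m' x k * m x k := by
      rw [hC, hdiag]; ring
    rw [hxx]
    have : ∑ x', (∑ k, m' x k * m x' k) * q x x' = ∑ k, m' x k * ∑ x', m x' k * q x x' := by
      simp only [Finset.sum_mul, Finset.mul_sum]
      rw [Finset.sum_comm]
      simp only [mul_assoc]
    rw [this]
    simp only [Finset.sum_mul, mul_add, Finset.sum_add_distrib, Finset.mul_sum]
    congr 1
    · exact Finset.sum_congr rfl fun _ _ => by ring
    · exact Finset.sum_congr rfl fun _ _ => Finset.sum_congr rfl fun _ _ => by ring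
  rw [hint]
  simp_rw [hsum]
  have hxle : ∀ x, s * (Real.sin θ * Real.cos θ * κ * g x)
      ≤ Real.sin θ * Real.cos θ * κ * g x + (s - 1) * ∑ x', (∑ k, m' x k * m x' k) * q x x' := by
    intro x
    have : ∑ x', (∑ k, m' x k * m x' k) * q x x' ≤ Real.sin θ * Real.cos θ * κ * g x := by
      rw [← hqg, Finset.mul_sum]
      refine Finset.sum_le_sum fun x' _ => mul_le_mul_of_nonneg_right ?_ (hq0 x x')
      rw [hC]
      exact mul_le_mul_of_nonneg_left (by linarith [hle x x']) (mul_nonneg hsin hcos)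
    nlinarith
  calc (β * s) ^ 2 * κ * (Real.sin θ * Real.cos θ) * F
      = β * s * ∑ x, β * (s * (Real.sin θ * Real.cos θ * κ * g x)) := by
        simp only [← Finset.mul_sum, hgF]; ring
    _ ≤ _ := mul_le_mul_of_nonneg_left (Finset.sum_le_sum fun x _ =>
        mul_le_mul_of_nonneg_left (hxle x) hβ) (mul_nonneg hβ hs0)

/-- Kahane's comparison inequality for powers of partition functions, for two orthogonal fields. -/
theorem integral_partitionFn_rpow_mul_exp_le_of_orthogonal {β s κ : ℝ} (hβ : 0 ≤ β) (hs0 : 0 ≤ s)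
    (hs1 : s ≤ 1) {a b : T → K → ℝ} (hab : ∀ x y, ∑ k, a x k * b y k = 0)
    (hdiag : ∀ x, ∑ k, b x k * b x k = ∑ k, a x k * a x k + κ)
    (hle : ∀ x y, ∑ k, b x k * b y k ≤ ∑ k, a x k * a y k + κ) :
    (∫ ξ, partitionFn β (linField a ξ) ^ s ∂(stdGaussianPi K)) * Real.exp ((β * s) ^ 2 * κ / 2)
      ≤ ∫ ξ, partitionFn β (linField b ξ) ^ s ∂(stdGaussianPi K) := by
  set φ : ℝ → ℝ := fun θ =>
    ∫ ξ, partitionFn β (linField (rotate a b θ) ξ) ^ s ∂(stdGaussianPi K) with hφ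
  set ψ : ℝ → ℝ := fun θ => Real.exp (-((β * s) ^ 2 * κ / 2 * Real.sin θ ^ 2)) * φ θ with hψ
  have hd : ∀ θ, HasDerivAt ψ (Real.exp (-((β * s) ^ 2 * κ / 2 * Real.sin θ ^ 2)) *
      (-((β * s) ^ 2 * κ * (Real.sin θ * Real.cos θ) * φ θ)
        + ∫ ξ, β * s * ∑ x, linField (rotateDeriv a b θ) ξ x *
          gibbsWeight β s x (linField (rotate a b θ) ξ) ∂(stdGaussianPi K))) θ := fun θ => by
    have hsq : HasDerivAt (fun θ => -((β * s) ^ 2 * κ / 2 * Real.sin θ ^ 2))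
        (-((β * s) ^ 2 * κ * (Real.sin θ * Real.cos θ))) θ := by
      refine ((((Real.hasDerivAt_sin θ).pow 2).const_mul ((β * s) ^ 2 * κ / 2)).neg).congr_deriv ?_
      push_cast
      ring
    refine (hsq.exp.mul
      (hasDerivAt_integral_partitionFn_rotate hβ hs0 hs1 a b θ)).congr_deriv ?_
    simp only [hφ]
    ring
  have hmono : MonotoneOn ψ (Icc 0 (Real.pi / 2)) := by
    refine monotoneOn_of_deriv_nonneg (convex_Icc _ _)
      (fun θ _ => (hd θ).continuousAt.continuousWithinAt)
      (fun θ _ => (hd θ).differentiableAt.differentiableWithinAt) fun θ hθ => ?_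
    rw [interior_Icc] at hθ
    rw [(hd θ).deriv]
    refine mul_nonneg (Real.exp_pos _).le ?_
    have := le_integral_deriv_partitionFn_rotate hβ hs0 hs1 hab hdiag hle (θ := θ)
      (Real.sin_nonneg_of_nonneg_of_le_pi hθ.1.le (by linarith [hθ.2, Real.pi_pos]))
      (Real.cos_nonneg_of_neg_pi_div_two_le_of_le (by linarith [hθ.1, Real.pi_pos]) hθ.2.le)
    linarith
  have h := hmono (left_mem_Icc.2 (by positivity)) (right_mem_Icc.2 (by positivity))
    (by positivity : (0 : ℝ) ≤ Real.pi / 2)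
  have h0 : rotate a b 0 = a := by funext x k; simp [rotate]
  have h1 : rotate a b (Real.pi / 2) = b := by funext x k; simp [rotate]
  simp only [hψ, hφ, h0, h1, Real.sin_zero, Real.sin_pi_div_two] at h
  rw [Real.exp_neg] at h
  norm_num at h
  rw [Real.exp_neg, inv_mul_eq_div, le_div_iff₀ (Real.exp_pos _)] at h
  exact h

variable {I J : Type*} [Fintype I] [Fintype J]

/-- Kahane's comparison inequality for powers of partition functions: if the variances of the field
`b` exceed those of `a` by exactly `κ` and its covariances exceed those of `a` by at most `κ`, then
`b` has the larger expectation, even after the gain `exp ((β s)² κ / 2)` that adding an independent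
variable of variance `κ` to all of `a` would give. -/
theorem integral_partitionFn_rpow_mul_exp_le {β s κ : ℝ} (hβ : 0 ≤ β) (hs0 : 0 ≤ s) (hs1 : s ≤ 1)
    {a : T → I → ℝ} {b : T → J → ℝ}
    (hdiag : ∀ x, ∑ j, b x j * b x j = ∑ i, a x i * a x i + κ)
    (hle : ∀ x y, ∑ j, b x j * b y j ≤ ∑ i, a x i * a y i + κ) :
    (∫ ξ, partitionFn β (linField a ξ) ^ s ∂(stdGaussianPi I)) * Real.exp ((β * s) ^ 2 * κ / 2)
      ≤ ∫ η, partitionFn β (linField b η) ^ s ∂(stdGaussianPi J) := by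
  -- Both fields are realized on disjoint coordinates of one vector indexed by `I ⊕ J`.
  have h := integral_partitionFn_rpow_mul_exp_le_of_orthogonal (K := I ⊕ J) hβ hs0 hs1 (κ := κ)
    (a := fun x => Sum.elim (a x) 0) (b := fun x => Sum.elim 0 (b x))
    (fun x y => by simp) (fun x => by simpa using hdiag x) (fun x y => by simpa using hle x y)
  have ha : ∀ ξ : I ⊕ J → ℝ, linField (fun x => Sum.elim (a x) (0 : J → ℝ)) ξ
      = linField a fun i => ξ (Sum.inl i) := fun ξ => by
    funext x; simp [linField]
  have hb : ∀ ξ : I ⊕ J → ℝ, linField (fun x => Sum.elim (0 : I → ℝ) (b x)) ξ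
      = linField b fun j => ξ (Sum.inr j) := fun ξ => by
    funext x; simp [linField]
  simp_rw [ha, hb] at h
  have e1 := measurePreserving_comp_inl I J
  have e2 := measurePreserving_comp_inr I J
  have ca : Continuous fun ξ => partitionFn β (linField a ξ) ^ s :=
    (continuous_partitionFn_rpow β s).comp (continuous_linField a)
  have cb : Continuous fun η => partitionFn β (linField b η) ^ s :=
    (continuous_partitionFn_rpow β s).comp (continuous_linField b)
  rw [← e1.map_eq, ← e2.map_eq, integral_map e1.measurable.aemeasurable ca.aestronglyMeasurable,
    integral_map e2.measurable.aemeasurable cb.aestronglyMeasurable]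
  exact h

end Comparison

/-! ### Exponential moments and the error function -/

section ExponentialMoment

variable {T I J : Type*} [Fintype T] [Nonempty T] [Fintype I] [Fintype J]

/-- A bound for the exponential moment of any selection `M` from the field with coefficients `a`,
in particular of its maximum, by comparison with a field `b` that has coefficients bounded
by `r`. -/
theorem integral_exp_mul_selection_le {a : T → I → ℝ} {b : T → J → ℝ} {κ r l : ℝ}
    (hdiag : ∀ x, ∑ j, b x j * b x j = ∑ i, a x i * a x i + κ)
    (hle : ∀ x y, ∑ j, b x j * b y j ≤ ∑ i, a x i * a y i + κ)
    (hr : ∀ x j, |b x j| ≤ r) (hl : 0 < l)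
    {M : (I → ℝ) → ℝ} (hM : Measurable M) (hMa : ∀ ξ, ∃ x, M ξ = linField a ξ x) :
    Integrable (fun ξ => Real.exp (l * M ξ)) (stdGaussianPi I) ∧
      ∫ ξ, Real.exp (l * M ξ) ∂(stdGaussianPi I) ≤ Real.exp (-(l ^ 2 * κ / 2)) *
        (∫ x, Real.exp (l * r * |x|) ∂(gaussianReal 0 1)) ^ Fintype.card J := by
  have hint : Integrable (fun ξ => Real.exp (l * M ξ)) (stdGaussianPi I) := by
    obtain ⟨A, -, hA⟩ := exists_abs_le a
    refine integrable_stdGaussianPi_of_le (hM.const_mul l).exp 1 (l * A) fun ξ => ?_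
    obtain ⟨x, hx⟩ := hMa ξ
    rw [abs_of_pos (Real.exp_pos _), one_mul, hx, mul_assoc]
    exact Real.exp_le_exp.2 (mul_le_mul_of_nonneg_left
      ((le_abs_self _).trans (abs_linField_le hA ξ x)) hl.le)
  refine ⟨hint, ?_⟩
  -- The maximum is bounded by the soft maximum with exponent `s` at inverse temperature `l / s`,
  -- at the cost of the entropic factor `|T| ^ s`, which disappears as `s → 0`.
  have key : ∀ s ∈ Ioc (0 : ℝ) 1, ∫ ξ, Real.exp (l * M ξ) ∂(stdGaussianPi I) ≤
      (Fintype.card T : ℝ) ^ s * (Real.exp (-(l ^ 2 * κ / 2)) *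
        (∫ x, Real.exp (l * r * |x|) ∂(gaussianReal 0 1)) ^ Fintype.card J) := by
    intro s hs
    have hβ : 0 ≤ l / s := div_nonneg hl.le hs.1.le
    have hβs : l / s * s = l := div_mul_cancel₀ l hs.1.ne'
    have h1 : ∫ ξ, Real.exp (l * M ξ) ∂(stdGaussianPi I)
        ≤ ∫ ξ, partitionFn (l / s) (linField a ξ) ^ s ∂(stdGaussianPi I) := by
      refine integral_mono hint (integrable_partitionFn_rpow hβ hs.1.le hs.2 a) fun ξ => ?_
      obtain ⟨x, hx⟩ := hMa ξ
      calc Real.exp (l * M ξ) = Real.exp (l / s * linField a ξ x) ^ s := by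
            rw [← Real.exp_mul, hx, ← hβs]; congr 1; field_simp
        _ ≤ _ := Real.rpow_le_rpow (Real.exp_pos _).le (exp_le_partitionFn _ _ x) hs.1.le
    have h2 := integral_partitionFn_rpow_mul_exp_le hβ hs.1.le hs.2 hdiag hle
    rw [hβs] at h2
    have h3 : ∫ η, partitionFn (l / s) (linField b η) ^ s ∂(stdGaussianPi J)
        ≤ (Fintype.card T : ℝ) ^ s *
          (∫ x, Real.exp (l * r * |x|) ∂(gaussianReal 0 1)) ^ Fintype.card J := by
      rw [← integral_exp_mul_sum_abs, ← integral_const_mul]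
      refine integral_mono (integrable_partitionFn_rpow hβ hs.1.le hs.2 b)
        ((integrable_exp_mul_sum_abs _).const_mul _) fun η => ?_
      have : partitionFn (l / s) (linField b η)
          ≤ Fintype.card T * Real.exp (l / s * (r * ∑ j, |η j|)) := by
        unfold partitionFn
        refine (Finset.sum_le_card_nsmul _ _ (Real.exp (l / s * (r * ∑ j, |η j|)))
          fun x _ => ?_).trans (by simp)
        exact Real.exp_le_exp.2 (mul_le_mul_of_nonneg_left
          ((le_abs_self _).trans (abs_linField_le hr η x)) hβ)
      refine (Real.rpow_le_rpow (partitionFn_pos _ _).le this hs.1.le).trans (le_of_eq ?_)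
      rw [Real.mul_rpow (by positivity) (Real.exp_pos _).le, ← Real.exp_mul]
      congr 2
      have := hs.1.ne'
      field_simp
    rw [← le_div_iff₀ (Real.exp_pos _)] at h2
    calc _ ≤ _ := h1.trans h2
      _ ≤ ((Fintype.card T : ℝ) ^ s * (∫ x, Real.exp (l * r * |x|) ∂(gaussianReal 0 1)) ^
          Fintype.card J) / Real.exp (l ^ 2 * κ / 2) := by gcongr
      _ = _ := by rw [Real.exp_neg]; ring
  have hlim : Tendsto (fun s : ℝ => (Fintype.card T : ℝ) ^ s * (Real.exp (-(l ^ 2 * κ / 2)) *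
        (∫ x, Real.exp (l * r * |x|) ∂(gaussianReal 0 1)) ^ Fintype.card J)) (𝓝[>] 0)
      (𝓝 ((Fintype.card T : ℝ) ^ (0 : ℝ) * (Real.exp (-(l ^ 2 * κ / 2)) *
        (∫ x, Real.exp (l * r * |x|) ∂(gaussianReal 0 1)) ^ Fintype.card J))) := by
    refine Tendsto.mul_const _ (Tendsto.mono_left ?_ nhdsWithin_le_nhds)
    exact (Real.continuous_const_rpow (by simp)).tendsto 0
  rw [Real.rpow_zero, one_mul] at hlim
  refine ge_of_tendsto hlim ?_
  filter_upwards [Ioc_mem_nhdsGT (zero_lt_one' ℝ)] with s hs using key s hs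

end ExponentialMoment

section Erfc

theorem integrable_exp_neg_sq : Integrable fun t : ℝ => Real.exp (-t ^ 2) := by
  simpa using integrable_exp_neg_mul_sq (zero_lt_one' ℝ)

theorem hasDerivAt_erfc (x : ℝ) :
    HasDerivAt erfc (-(2 / Real.sqrt Real.pi * Real.exp (-x ^ 2))) x := by
  have hc : Continuous fun t : ℝ => Real.exp (-t ^ 2) := by fun_prop
  have h : ∀ y, ∫ t in Ioi y, Real.exp (-t ^ 2)
      = (∫ t in Ioi 0, Real.exp (-t ^ 2)) - ∫ t in (0 : ℝ)..y, Real.exp (-t ^ 2) := fun y => by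
    rw [← intervalIntegral.integral_interval_add_Ioi' (hc.intervalIntegrable 0 y)
      integrable_exp_neg_sq.integrableOn]
    ring
  have h2 : HasDerivAt (fun y => ∫ t in Ioi y, Real.exp (-t ^ 2)) (-Real.exp (-x ^ 2)) x := by
    rw [funext h]
    exact ((hc.integral_hasStrictDerivAt 0 x).hasDerivAt).const_sub _
  refine (h2.const_mul (2 / Real.sqrt Real.pi)).congr_deriv (by ring)

theorem erfc_pos (x : ℝ) : 0 < erfc x := by
  unfold erfc
  refine mul_pos (by positivity) ?_
  rw [setIntegral_pos_iff_support_of_nonneg_ae (ae_of_all _ fun t => (Real.exp_pos _).le)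
    integrable_exp_neg_sq.integrableOn]
  have : Function.support (fun t : ℝ => Real.exp (-t ^ 2)) = univ :=
    Function.support_eq_univ fun t => (Real.exp_pos _).ne'
  rw [this, univ_inter, Real.volume_Ioi]
  exact ENNReal.zero_lt_top

theorem erfc_zero : erfc 0 = 1 := by
  have h := integral_gaussian_Ioi 1
  simp only [neg_mul, one_mul, div_one] at h
  unfold erfc
  rw [h]
  field_simp

/-- The moment generating function of `|h|` for a standard normal `h`. -/
theorem integral_exp_mul_abs_gaussianReal (C : ℝ) :
    ∫ x, Real.exp (C * |x|) ∂(gaussianReal 0 1)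
      = Real.exp (C ^ 2 / 2) * erfc (-C / Real.sqrt 2) := by
  have h2 : (0 : ℝ) < Real.sqrt 2 := by positivity
  rw [integral_gaussianReal_eq_integral_smul one_ne_zero]
  have e1 : ∀ x : ℝ, gaussianPDFReal 0 1 x • Real.exp (C * |x|)
      = (fun y => Real.exp (C ^ 2 / 2) * (Real.sqrt (2 * Real.pi))⁻¹ *
        Real.exp (-((y - C) / Real.sqrt 2) ^ 2)) |x| := fun x => by
    simp only [gaussianPDFReal, smul_eq_mul, NNReal.coe_one, mul_one, sub_zero]
    rw [mul_assoc, ← Real.exp_add, mul_comm (Real.exp (C ^ 2 / 2)), mul_assoc, ← Real.exp_add,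
      div_pow, Real.sq_sqrt (by norm_num : (0 : ℝ) ≤ 2), ← sq_abs x]
    congr 2
    ring
  simp_rw [e1]
  rw [integral_comp_abs (f := fun y => Real.exp (C ^ 2 / 2) * (Real.sqrt (2 * Real.pi))⁻¹ *
        Real.exp (-((y - C) / Real.sqrt 2) ^ 2)), integral_const_mul]
  have e2 : ∫ y in Ioi (0 : ℝ), Real.exp (-((y - C) / Real.sqrt 2) ^ 2)
      = Real.sqrt 2 * ∫ t in Ioi (-C / Real.sqrt 2), Real.exp (-t ^ 2) := by
    have h : ∀ y, (Ioi (0 : ℝ)).indicator (fun y => Real.exp (-((y - C) / Real.sqrt 2) ^ 2)) y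
        = (Ioi (-C / Real.sqrt 2)).indicator (fun t => Real.exp (-t ^ 2))
          ((y - C) / Real.sqrt 2) := fun y => by
      have : y ∈ Ioi (0 : ℝ) ↔ (y - C) / Real.sqrt 2 ∈ Ioi (-C / Real.sqrt 2) := by
        rw [mem_Ioi, mem_Ioi, div_lt_div_iff_of_pos_right h2]
        constructor <;> intro h <;> linarith
      simp only [indicator, this]
    rw [← integral_indicator measurableSet_Ioi, ← integral_indicator measurableSet_Ioi]
    simp_rw [h]
    rw [integral_sub_right_eq_self (fun y => (Ioi (-C / Real.sqrt 2)).indicator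
      (fun t => Real.exp (-t ^ 2)) (y / Real.sqrt 2)) C, Measure.integral_comp_div,
      abs_of_pos h2, smul_eq_mul]
  rw [e2, erfc, Real.sqrt_mul (by norm_num)]
  field_simp

end Erfc

/-! ### Calculus of the rate function -/

section Rate

/-- The function `c ↦ erfc (-c√p/√2)`, which is `2Φ(c√p)` for the standard normal distribution
function `Φ`. -/
def scaledErfc (p : ℕ) (c : ℝ) : ℝ :=
  erfc (-(c * Real.sqrt p) / Real.sqrt 2)

/-- The derivative of `scaledErfc p` at `0`. -/
def erfcSlope (p : ℕ) : ℝ :=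
  Real.sqrt (2 * p / Real.pi)

/-- The function `c ↦ c/2 + (1/c) log erfc (-c√p/√2)`, whose minimum is `uGS p`. -/
def groundStateBound (p : ℕ) (c : ℝ) : ℝ :=
  c / 2 + 1 / c * Real.log (scaledErfc p c)

theorem erfcSlope_pos {p : ℕ} (hp : 2 ≤ p) : 0 < erfcSlope p := by
  have : (0 : ℝ) < p := by exact_mod_cast (by omega : 0 < p)
  unfold erfcSlope
  positivity

theorem scaledErfc_pos (p : ℕ) (c : ℝ) : 0 < scaledErfc p c := erfc_pos _

theorem scaledErfc_zero (p : ℕ) : scaledErfc p 0 = 1 := by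
  simp [scaledErfc, erfc_zero]

theorem hasDerivAt_scaledErfc (p : ℕ) (c : ℝ) :
    HasDerivAt (scaledErfc p) (erfcSlope p * Real.exp (-(c ^ 2 * p / 2))) c := by
  have h1 : HasDerivAt (fun c => -(c * Real.sqrt p) / Real.sqrt 2)
      (-(1 * Real.sqrt p) / Real.sqrt 2) c :=
    (((hasDerivAt_id c).mul_const _).neg).div_const _
  refine ((hasDerivAt_erfc _).comp c h1).congr_deriv ?_
  have h2 : (-(c * Real.sqrt p) / Real.sqrt 2) ^ 2 = c ^ 2 * p / 2 := by
    rw [div_pow, neg_sq, mul_pow, Real.sq_sqrt (by positivity), Real.sq_sqrt (by norm_num)]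
  rw [h2, erfcSlope, Real.sqrt_div (by positivity), Real.sqrt_mul (by norm_num)]
  have h5 : (2 : ℝ) / Real.sqrt 2 = Real.sqrt 2 := Real.div_sqrt
  calc _ = (2 : ℝ) / Real.sqrt 2 * Real.sqrt p / Real.sqrt Real.pi *
        Real.exp (-(c ^ 2 * p / 2)) := by ring
    _ = _ := by rw [h5]

theorem monotone_scaledErfc (p : ℕ) : Monotone (scaledErfc p) :=
  monotone_of_deriv_nonneg (fun c => (hasDerivAt_scaledErfc p c).differentiableAt) fun c => by
    rw [(hasDerivAt_scaledErfc p c).deriv]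
    exact mul_nonneg (Real.sqrt_nonneg _) (Real.exp_pos _).le

theorem log_scaledErfc_nonneg (p : ℕ) {c : ℝ} (hc : 0 ≤ c) : 0 ≤ Real.log (scaledErfc p c) :=
  Real.log_nonneg ((scaledErfc_zero p).symm.le.trans (monotone_scaledErfc p hc))

theorem hasDerivAt_log_scaledErfc (p : ℕ) (c : ℝ) :
    HasDerivAt (fun c => Real.log (scaledErfc p c))
      (erfcSlope p * Real.exp (-(c ^ 2 * p / 2)) / scaledErfc p c) c :=
  (hasDerivAt_scaledErfc p c).log (scaledErfc_pos p c).ne'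

theorem isingObjective_eq (p : ℕ) (u c : ℝ) :
    isingObjective p u c = c ^ 2 / 2 + Real.log (scaledErfc p c) - c * u := rfl

theorem isingObjective_eq_mul (p : ℕ) (u : ℝ) {c : ℝ} (hc : c ≠ 0) :
    isingObjective p u c = c * (groundStateBound p c - u) := by
  rw [isingObjective_eq, groundStateBound]
  field_simp

theorem hasDerivAt_isingObjective (p : ℕ) (u c : ℝ) :
    HasDerivAt (isingObjective p u)
      (c + erfcSlope p * Real.exp (-(c ^ 2 * p / 2)) / scaledErfc p c - u) c := by
  have h := ((((hasDerivAt_id c).pow 2).div_const 2).add (hasDerivAt_log_scaledErfc p c)).sub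
    ((hasDerivAt_id c).mul_const u)
  refine h.congr_deriv ?_
  simp only [id]
  push_cast
  ring

/-- The first-order condition at a minimizer. -/
theorem IsIsingArgmin.sub_eq {p : ℕ} {u c : ℝ} (h : IsIsingArgmin p u c) :
    u - c = erfcSlope p * Real.exp (-(c ^ 2 * p / 2)) / scaledErfc p c := by
  have := (h.2.isLocalMin (Ioi_mem_nhds h.1)).hasDerivAt_eq_zero (hasDerivAt_isingObjective p u c)
  linarith

theorem erfcSlope_mul_sqrt {p : ℕ} (hp : 2 ≤ p) :
    erfcSlope p * Real.sqrt (Real.pi / (2 * p)) = 1 := by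
  have : (0 : ℝ) < p := by exact_mod_cast (by omega : 0 < p)
  have hpi := Real.pi_pos
  rw [erfcSlope, ← Real.sqrt_mul (by positivity), Real.sqrt_eq_one]
  field_simp

theorem IsIsingArgmin.lt {p : ℕ} (hp : 2 ≤ p) {u c : ℝ} (h : IsIsingArgmin p u c) : c < u := by
  have h1 := h.sub_eq
  have h2 : 0 < erfcSlope p * Real.exp (-(c ^ 2 * p / 2)) / scaledErfc p c :=
    div_pos (mul_pos (erfcSlope_pos hp) (Real.exp_pos _)) (scaledErfc_pos p c)
  linarith

theorem IsIsingArgmin.one_div_scaledErfc {p : ℕ} (hp : 2 ≤ p) {u c : ℝ}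
    (h : IsIsingArgmin p u c) :
    1 / scaledErfc p c
      = Real.exp (c ^ 2 * p / 2) * (u - c) * Real.sqrt (Real.pi / (2 * p)) := by
  have hE := (scaledErfc_pos p c).ne'
  calc 1 / scaledErfc p c
      = (Real.exp (c ^ 2 * p / 2) * Real.exp (-(c ^ 2 * p / 2))) *
        (erfcSlope p * Real.sqrt (Real.pi / (2 * p))) / scaledErfc p c := by
        rw [erfcSlope_mul_sqrt hp, ← Real.exp_add, add_neg_cancel, Real.exp_zero, one_mul]
    _ = _ := by rw [h.sub_eq]; ring

theorem IsIsingArgmin.isingPhi_eq {p : ℕ} (hp : 2 ≤ p) {u c : ℝ} (h : IsIsingArgmin p u c) :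
    isingPhi p u c = isingObjective p u c := by
  have hp0 : (0 : ℝ) < p := by exact_mod_cast (by omega : 0 < p)
  have h1 := congrArg Real.log (h.one_div_scaledErfc hp)
  have hpos : 0 < Real.pi / (2 * p) := div_pos Real.pi_pos (by positivity)
  rw [one_div, Real.log_inv, Real.log_mul (mul_pos (Real.exp_pos _) (sub_pos.2 (h.lt hp))).ne'
    (Real.sqrt_pos.2 hpos).ne', Real.log_mul (Real.exp_pos _).ne' (sub_pos.2 (h.lt hp)).ne',
    Real.log_exp, Real.log_sqrt hpos.le] at h1
  rw [isingObjective_eq, isingPhi]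
  linarith

/-- A continuous function on the open half-line that takes a value below its limit at `0` and
tends to infinity attains its minimum. -/
theorem exists_isMinOn_Ioi {f : ℝ → ℝ} {L : ℝ} (hf : ContinuousOn f (Ioi 0))
    (h0 : Tendsto f (𝓝[>] 0) (𝓝 L)) (hinf : Tendsto f atTop atTop)
    (hL : ∃ c, 0 < c ∧ f c < L) : ∃ c, 0 < c ∧ IsMinOn f (Ioi 0) c := by
  obtain ⟨d, hd, hdL⟩ := hL
  obtain ⟨ε, hε, h1⟩ := mem_nhdsGT_iff_exists_Ioo_subset.1 (h0.eventually_const_lt hdL)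
  obtain ⟨N, h2⟩ := eventually_atTop.1 (hinf.eventually_gt_atTop (f d))
  rw [mem_Ioi] at hε
  have hmin : 0 < min (ε / 2) d := lt_min (by linarith) hd
  have hsub : Icc (min (ε / 2) d) (max N d) ⊆ Ioi 0 := fun x hx => hmin.trans_le hx.1
  have hdm : d ∈ Icc (min (ε / 2) d) (max N d) := ⟨min_le_right _ _, le_max_right _ _⟩
  obtain ⟨c, hc, hcm⟩ := isCompact_Icc.exists_isMinOn ⟨d, hdm⟩ (hf.mono hsub)
  refine ⟨c, hsub hc, fun x hx => ?_⟩
  have hcd : f c ≤ f d := hcm hdm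
  rw [mem_Ioi] at hx
  rcases lt_or_ge x (min (ε / 2) d) with hlt | hge
  · exact hcd.trans (le_of_lt (h1 ⟨hx, by linarith [hlt.trans_le (min_le_left (ε / 2) d)]⟩))
  · rcases le_or_gt x (max N d) with hle | hgt
    · exact hcm ⟨hge, hle⟩
    · exact hcd.trans (h2 x ((le_max_left _ _).trans hgt.le)).le

theorem tendsto_groundStateBound_zero (p : ℕ) :
    Tendsto (groundStateBound p) (𝓝[>] 0) (𝓝 (erfcSlope p)) := by
  have h1 : Tendsto (fun c : ℝ => c / 2) (𝓝[>] 0) (𝓝 0) := by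
    have : Continuous fun c : ℝ => c / 2 := by fun_prop
    simpa using (this.tendsto 0).mono_left (nhdsWithin_le_nhds (s := Ioi 0))
  have h2 := (hasDerivAt_log_scaledErfc p 0).tendsto_slope.mono_left
    (nhdsWithin_mono 0 fun x (hx : x ∈ Ioi (0 : ℝ)) => (ne_of_gt hx : x ∈ ({0} : Set ℝ)ᶜ))
  have h3 := h1.add h2
  rw [zero_add] at h3
  simp only [scaledErfc_zero, div_one] at h3
  norm_num at h3
  refine h3.congr fun c => ?_
  simp [groundStateBound, slope_def_field, scaledErfc_zero, div_eq_inv_mul]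

theorem tendsto_groundStateBound_atTop (p : ℕ) :
    Tendsto (groundStateBound p) atTop atTop := by
  refine tendsto_atTop_mono' atTop ?_ (tendsto_id.atTop_div_const (zero_lt_two' ℝ))
  filter_upwards [eventually_gt_atTop (0 : ℝ)] with c hc
  have := mul_nonneg (one_div_pos.2 hc).le (log_scaledErfc_nonneg p hc.le)
  simp only [groundStateBound, id]
  linarith

theorem continuousOn_groundStateBound (p : ℕ) : ContinuousOn (groundStateBound p) (Ioi 0) := by
  intro c hc
  have h : ContinuousAt (fun c => Real.log (scaledErfc p c)) c :=
    (hasDerivAt_log_scaledErfc p c).continuousAt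
  have h2 : ContinuousAt (fun c : ℝ => 1 / c) c :=
    continuousAt_const.div continuousAt_id (ne_of_gt hc)
  exact ((continuousAt_id.div_const 2).add (h2.mul h)).continuousWithinAt

/-- Since `p > π / 2`, the second derivative of `c ↦ c²/2 + log erfc (-c√p/√2)` at `0`, which is
`1 - 2p/π`, is negative; so `groundStateBound p` lies below its limit at `0` somewhere. -/
theorem exists_groundStateBound_lt {p : ℕ} (hp : 2 ≤ p) :
    ∃ c, 0 < c ∧ groundStateBound p c < erfcSlope p := by
  set k := erfcSlope p with hk
  set g' : ℝ → ℝ := fun c => c + k * Real.exp (-(c ^ 2 * p / 2)) / scaledErfc p c - k with hg'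
  have hk1 : 1 < k ^ 2 := by
    have hp' : (2 : ℝ) ≤ p := by exact_mod_cast hp
    rw [hk, erfcSlope, Real.sq_sqrt (by positivity), lt_div_iff₀ Real.pi_pos]
    linarith [Real.pi_lt_four]
  have hd : HasDerivAt g' (1 - k ^ 2) 0 := by
    have he : HasDerivAt (fun c : ℝ => Real.exp (-(c ^ 2 * p / 2))) 0 0 := by
      have h : HasDerivAt (fun c : ℝ => -(c ^ 2 * p / 2)) 0 0 :=
        (((((hasDerivAt_id (0 : ℝ)).pow 2).mul_const (p : ℝ)).div_const 2).neg).congr_deriv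
          (by simp)
      exact h.exp.congr_deriv (by simp)
    have h := ((hasDerivAt_id (0 : ℝ)).add ((he.const_mul k).div (hasDerivAt_scaledErfc p 0)
      (scaledErfc_pos p 0).ne')).sub_const k
    refine h.congr_deriv ?_
    simp [scaledErfc_zero, ← hk]
    ring
  have hg0 : g' 0 = 0 := by simp [hg', scaledErfc_zero]
  have hneg : ∀ᶠ c in 𝓝[>] (0 : ℝ), g' c < 0 := by
    have h := (hd.tendsto_slope.mono_left (nhdsWithin_mono 0
      fun x (hx : x ∈ Ioi (0 : ℝ)) => (ne_of_gt hx : x ∈ ({0} : Set ℝ)ᶜ))).eventually_lt_const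
        (by linarith : 1 - k ^ 2 < 0)
    filter_upwards [h, self_mem_nhdsWithin] with c hc hc0
    rw [slope_def_field, hg0, sub_zero, sub_zero] at hc
    exact (div_neg_iff.1 hc).elim (fun h => absurd h.2 (not_lt.2 (le_of_lt hc0))) fun h => h.1
  obtain ⟨ε, hε, h1⟩ := mem_nhdsGT_iff_exists_Ioo_subset.1 hneg
  rw [mem_Ioi] at hε
  have hanti : StrictAntiOn (isingObjective p k) (Icc 0 (ε / 2)) := by
    refine strictAntiOn_of_deriv_neg (convex_Icc _ _)
      (fun c _ => (hasDerivAt_isingObjective p k c).continuousAt.continuousWithinAt)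
      fun c hc => ?_
    rw [interior_Icc] at hc
    rw [(hasDerivAt_isingObjective p k c).deriv]
    exact h1 ⟨hc.1, by linarith [hc.2]⟩
  have h := hanti (left_mem_Icc.2 (by linarith)) (right_mem_Icc.2 (by linarith))
    (by linarith : (0 : ℝ) < ε / 2)
  have h0 : isingObjective p k 0 = 0 := by simp [isingObjective_eq, scaledErfc_zero]
  rw [h0, isingObjective_eq_mul p k (by positivity : ε / 2 ≠ 0)] at h
  exact ⟨ε / 2, by positivity, by
    by_contra! hcon
    have : 0 ≤ ε / 2 * (groundStateBound p (ε / 2) - k) :=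
      mul_nonneg (by positivity) (by linarith)
    linarith⟩

theorem exists_isMinOn_groundStateBound {p : ℕ} (hp : 2 ≤ p) :
    ∃ c, 0 < c ∧ IsMinOn (groundStateBound p) (Ioi 0) c :=
  exists_isMinOn_Ioi (continuousOn_groundStateBound p) (tendsto_groundStateBound_zero p)
    (tendsto_groundStateBound_atTop p) (exists_groundStateBound_lt hp)

/-- A negative value of the objective forces the existence of a minimizer. -/
theorem exists_isIsingArgmin {p : ℕ} {u c : ℝ} (hc : 0 < c) (h : groundStateBound p c < u) :
    ∃ d, IsIsingArgmin p u d := by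
  refine exists_isMinOn_Ioi (f := isingObjective p u) (L := 0)
    (fun c _ => (hasDerivAt_isingObjective p u c).continuousAt.continuousWithinAt) ?_ ?_
    ⟨c, hc, ?_⟩
  · have := (hasDerivAt_isingObjective p u 0).continuousAt.tendsto
    rw [show isingObjective p u 0 = 0 by simp [isingObjective_eq, scaledErfc_zero]] at this
    exact this.mono_left nhdsWithin_le_nhds
  · have h1 : Tendsto (fun c => c * (groundStateBound p c - u)) atTop atTop :=
      tendsto_id.atTop_mul_atTop₀
        (tendsto_atTop_add_const_right _ (-u) (tendsto_groundStateBound_atTop p))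
    refine h1.congr' ?_
    filter_upwards [eventually_gt_atTop (0 : ℝ)] with c hc
    exact (isingObjective_eq_mul p u hc.ne').symm
  · rw [isingObjective_eq_mul p u hc.ne']
    exact mul_neg_of_pos_of_neg hc (by linarith)

theorem negativeRateSet_eq {p : ℕ} (hp : 2 ≤ p) {c : ℝ} (hc : 0 < c)
    (hmin : IsMinOn (groundStateBound p) (Ioi 0) c) :
    negativeRateSet p = Ioi (groundStateBound p c) := by
  ext u
  constructor
  · rintro ⟨d, hd, hneg⟩
    rw [hd.isingPhi_eq hp, isingObjective_eq_mul p u hd.1.ne'] at hneg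
    have h1 : groundStateBound p d - u < 0 := by
      by_contra! h
      exact absurd hneg (not_lt.2 (mul_nonneg hd.1.le h))
    have h2 : groundStateBound p c ≤ groundStateBound p d := hmin hd.1
    rw [mem_Ioi]
    linarith
  · intro hu
    rw [mem_Ioi] at hu
    obtain ⟨d, hd⟩ := exists_isIsingArgmin hc hu
    refine ⟨d, hd, ?_⟩
    rw [hd.isingPhi_eq hp]
    refine lt_of_le_of_lt (hd.2 hc : isingObjective p u d ≤ isingObjective p u c) ?_
    rw [isingObjective_eq_mul p u hc.ne']
    exact mul_neg_of_pos_of_neg hc (by linarith)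

theorem uGS_eq {p : ℕ} (hp : 2 ≤ p) {c : ℝ} (hc : 0 < c)
    (hmin : IsMinOn (groundStateBound p) (Ioi 0) c) : uGS p = groundStateBound p c := by
  rw [uGS, negativeRateSet_eq hp hc hmin, csInf_Ioi]

theorem isGLB_uGS {p : ℕ} (hp : 2 ≤ p) : IsGLB (negativeRateSet p) (uGS p) := by
  obtain ⟨c, hc, hmin⟩ := exists_isMinOn_groundStateBound hp
  rw [uGS_eq hp hc hmin, negativeRateSet_eq hp hc hmin]
  exact isGLB_Ioi

theorem isLeast_uGS {p : ℕ} (hp : 2 ≤ p) :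
    IsLeast (groundStateBound p '' Ioi 0) (uGS p) := by
  obtain ⟨c, hc, hmin⟩ := exists_isMinOn_groundStateBound hp
  rw [uGS_eq hp hc hmin]
  refine ⟨⟨c, hc, rfl⟩, ?_⟩
  rintro _ ⟨d, hd, rfl⟩
  exact hmin hd

theorem exists_isIsingArgmin_of_uGS_le {p : ℕ} (hp : 2 ≤ p) {u : ℝ} (hu : uGS p ≤ u) :
    ∃ c, IsIsingArgmin p u c := by
  obtain ⟨c, hc, hmin⟩ := exists_isMinOn_groundStateBound hp
  rw [uGS_eq hp hc hmin] at hu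
  rcases hu.lt_or_eq with h | rfl
  · exact exists_isIsingArgmin hc h
  -- At the threshold the objective is nonnegative, and it vanishes at the minimizer of the ratio.
  · refine ⟨c, hc, fun d hd => ?_⟩
    change isingObjective p _ c ≤ isingObjective p _ d
    rw [isingObjective_eq_mul p _ hc.ne', isingObjective_eq_mul p _ (ne_of_gt hd), sub_self,
      mul_zero]
    exact mul_nonneg (le_of_lt hd) (sub_nonneg.2 (hmin hd))

end Rate

/-! ### The Ising spin fields -/

section SpinFields

/-- The coefficients of the field `x ↦ tensorForm ξ x`, as a linear function of the disorder. -/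
def tensorCoeff {p n : ℕ} (x : Fin p → Fin n → ℝ) (i : Fin p → Fin n) : ℝ :=
  ∏ j, x j (i j)

theorem tensorForm_eq_linField {T : Type*} {p n : ℕ} (e : T → Fin p → Fin n → ℝ)
    (ξ : (Fin p → Fin n) → ℝ) (x : T) :
    tensorForm ξ (e x) = linField (fun x => tensorCoeff (e x)) ξ x :=
  Finset.sum_congr rfl fun _ _ => mul_comm _ _

theorem sum_tensorCoeff_mul {p n : ℕ} (x y : Fin p → Fin n → ℝ) :
    ∑ i, tensorCoeff x i * tensorCoeff y i = ∏ j, ∑ k, x j k * y j k := by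
  simp only [tensorCoeff, ← Finset.prod_mul_distrib]
  rw [Finset.prod_univ_sum, Fintype.piFinset_univ]

theorem abs_apply_of_mem_isingCube {n : ℕ} {x : Fin n → ℝ} (hx : x ∈ isingCube n) (i : Fin n) :
    |x i| = 1 / Real.sqrt n := by
  rw [← Real.sqrt_sq_eq_abs, hx i, Real.sqrt_div zero_le_one, Real.sqrt_one]

theorem sum_mul_self_of_mem_isingCube {n : ℕ} (hn : 0 < n) {x : Fin n → ℝ}
    (hx : x ∈ isingCube n) : ∑ i, x i * x i = 1 := by
  have hn' : (n : ℝ) ≠ 0 := by exact_mod_cast hn.ne'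
  have : ∀ i, x i * x i = 1 / (n : ℝ) := fun i => by rw [← sq]; exact hx i
  simp only [this, Finset.sum_const, Finset.card_univ, Fintype.card_fin, nsmul_eq_mul]
  field_simp

theorem abs_sum_mul_le_one {n : ℕ} {x y : Fin n → ℝ} (hx : x ∈ isingCube n)
    (hy : y ∈ isingCube n) : |∑ i, x i * y i| ≤ 1 := by
  have : ∀ i, |x i * y i| = 1 / (n : ℝ) := fun i => by
    rw [abs_mul, abs_apply_of_mem_isingCube hx, abs_apply_of_mem_isingCube hy,
      div_mul_div_comm, one_mul, Real.mul_self_sqrt (Nat.cast_nonneg n)]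
  refine (Finset.abs_sum_le_sum_abs _ _).trans ?_
  simp only [this, Finset.sum_const, Finset.card_univ, Fintype.card_fin, nsmul_eq_mul]
  rw [mul_one_div]
  exact div_self_le_one _

/-- A Bernoulli-type inequality for products of numbers in `[-1, 1]`. -/
theorem sum_add_one_le_prod_add_card {ι : Type*} (s : Finset ι) {t : ι → ℝ}
    (ht : ∀ j, |t j| ≤ 1) : ∑ j ∈ s, t j + 1 ≤ ∏ j ∈ s, t j + s.card := by
  classical
  induction s using Finset.induction_on with
  | empty => simp
  | insert j s hj ih =>
    rw [Finset.sum_insert hj, Finset.prod_insert hj, Finset.card_insert_of_notMem hj]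
    have h1 : |∏ j ∈ s, t j| ≤ 1 := by
      rw [Finset.abs_prod]
      exact Finset.prod_le_one (fun _ _ => abs_nonneg _) fun j _ => ht j
    have h2 := mul_nonneg (sub_nonneg.2 (abs_le.1 (ht j)).2) (sub_nonneg.2 (abs_le.1 h1).2)
    push_cast
    nlinarith

theorem integrable_selection {T I : Type*} [Fintype T] [Fintype I] {a : T → I → ℝ}
    {M : (I → ℝ) → ℝ} (hM : Measurable M) (hMa : ∀ ξ, ∃ x, M ξ = linField a ξ x) :
    Integrable M (stdGaussianPi I) := by
  obtain ⟨A, hA0, hA⟩ := exists_abs_le a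
  refine integrable_stdGaussianPi_of_le hM A 1 fun ξ => ?_
  obtain ⟨x, hx⟩ := hMa ξ
  rw [hx, one_mul]
  exact (abs_linField_le hA ξ x).trans
    (mul_le_mul_of_nonneg_left ((lt_add_one _).le.trans (Real.add_one_le_exp _)) hA0)

theorem measurable_tensorForm {p n : ℕ} (x : Fin p → Fin n → ℝ) :
    Measurable fun ξ : (Fin p → Fin n) → ℝ => tensorForm ξ x := by
  unfold tensorForm; fun_prop

instance finite_isingCube (n : ℕ) : Finite (isingCube n) := (isingCube_finite n).to_subtype

instance nonempty_isingCube (n : ℕ) : Nonempty (isingCube n) := (isingCube_nonempty n).to_subtype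

instance fintype_isingCube (n : ℕ) : Fintype (isingCube n) := Fintype.ofFinite _

theorem measurable_singleMax (p n : ℕ) :
    Measurable (singleMax (p := p) (isingCube n)) :=
  Measurable.iSup fun _ => measurable_tensorForm _

theorem measurable_multiMax (p n : ℕ) :
    Measurable (multiMax fun _ : Fin p => isingCube n) :=
  Measurable.iSup fun _ => measurable_tensorForm _

theorem exists_singleMax_eq {p n : ℕ} (ξ : (Fin p → Fin n) → ℝ) :
    ∃ x : isingCube n, singleMax (isingCube n) ξ
      = linField (fun x : isingCube n => tensorCoeff fun _ => (x : Fin n → ℝ)) ξ x := by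
  obtain ⟨x, hx⟩ := exists_eq_ciSup_of_finite
    (f := fun x : isingCube n => tensorForm ξ fun _ => (x : Fin n → ℝ))
  exact ⟨x, hx.symm.trans (tensorForm_eq_linField (fun (x : isingCube n) _ => (x : Fin n → ℝ)) ξ x)⟩

theorem exists_multiMax_eq {p n : ℕ} (ξ : (Fin p → Fin n) → ℝ) :
    ∃ x : Fin p → isingCube n, multiMax (fun _ => isingCube n) ξ
      = linField (fun x : Fin p → isingCube n => tensorCoeff fun j => (x j : Fin n → ℝ)) ξ x := by
  obtain ⟨x, hx⟩ := exists_eq_ciSup_of_finite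
    (f := fun x : Fin p → isingCube n => tensorForm ξ fun j => (x j : Fin n → ℝ))
  exact ⟨x, hx.symm.trans
    (tensorForm_eq_linField (fun (x : Fin p → isingCube n) j => (x j : Fin n → ℝ)) ξ x)⟩

theorem integrable_singleMax (p n : ℕ) :
    Integrable (singleMax (isingCube n)) (stdGaussianPi (Fin p → Fin n)) :=
  integrable_selection (measurable_singleMax p n) exists_singleMax_eq

theorem integrable_multiMax (p n : ℕ) :
    Integrable (multiMax fun _ => isingCube n) (stdGaussianPi (Fin p → Fin n)) :=
  integrable_selection (measurable_multiMax p n) exists_multiMax_eq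

theorem integral_exp_mul_abs_eq_scaledErfc (p : ℕ) (c : ℝ) :
    ∫ x, Real.exp (c * Real.sqrt p * |x|) ∂(gaussianReal 0 1)
      = Real.exp (c ^ 2 * p / 2 + Real.log (scaledErfc p c)) := by
  rw [integral_exp_mul_abs_gaussianReal, Real.exp_add, Real.exp_log (scaledErfc_pos p c), mul_pow,
    Real.sq_sqrt (Nat.cast_nonneg p)]
  rfl

/-- The exponential moment of the ground state energy: the comparison field is
`x ↦ √p ∑ₖ ηₖ xₖ`. -/
theorem integral_exp_singleMax_le (p : ℕ) {n : ℕ} (hn : 0 < n) {c : ℝ} (hc : 0 < c) :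
    Integrable (fun ξ => Real.exp (c * Real.sqrt n * singleMax (isingCube n) ξ))
        (stdGaussianPi (Fin p → Fin n)) ∧
      ∫ ξ, Real.exp (c * Real.sqrt n * singleMax (isingCube n) ξ)
        ∂(stdGaussianPi (Fin p → Fin n))
      ≤ Real.exp (n * (c ^ 2 / 2 + Real.log (scaledErfc p c))) := by
  have hn' : (0 : ℝ) < n := by exact_mod_cast hn
  have hsn : 0 < Real.sqrt n := Real.sqrt_pos.2 hn'
  have hcov : ∀ x y : isingCube n, ∑ k, (Real.sqrt p * (x : Fin n → ℝ) k) *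
      (Real.sqrt p * (y : Fin n → ℝ) k) = p * ∑ k, (x : Fin n → ℝ) k * (y : Fin n → ℝ) k :=
    fun x y => by
      rw [Finset.mul_sum]
      refine Finset.sum_congr rfl fun k _ => ?_
      rw [mul_mul_mul_comm, Real.mul_self_sqrt (Nat.cast_nonneg p)]
  have h := integral_exp_mul_selection_le (T := isingCube n)
    (a := fun x => tensorCoeff fun _ : Fin p => (x : Fin n → ℝ))
    (b := fun x k => Real.sqrt p * (x : Fin n → ℝ) k) (κ := p - 1)
    (r := Real.sqrt p / Real.sqrt n) (l := c * Real.sqrt n)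
    (fun x => by
      rw [hcov, sum_tensorCoeff_mul]
      simp [sum_mul_self_of_mem_isingCube hn x.2])
    (fun x y => by
      rw [hcov, sum_tensorCoeff_mul]
      have := sum_add_one_le_prod_add_card (Finset.univ : Finset (Fin p))
        fun _ => abs_sum_mul_le_one x.2 y.2
      simp only [Finset.sum_const, Finset.card_univ, Fintype.card_fin, nsmul_eq_mul] at this
      linarith)
    (fun x k => by
      rw [abs_mul, abs_apply_of_mem_isingCube x.2, abs_of_nonneg (Real.sqrt_nonneg _), mul_one_div])
    (mul_pos hc hsn) (measurable_singleMax p n) exists_singleMax_eq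
  refine ⟨h.1, h.2.trans (le_of_eq ?_)⟩
  rw [show c * Real.sqrt n * (Real.sqrt p / Real.sqrt n) = c * Real.sqrt p by field_simp,
    integral_exp_mul_abs_eq_scaledErfc, ← Real.exp_nat_mul, ← Real.exp_add, mul_pow,
    Real.sq_sqrt hn'.le, Fintype.card_fin]
  congr 1
  ring

/-- The exponential moment of the multipartite ground state energy: the comparison field is
`(x⁽ʲ⁾)ⱼ ↦ ∑ⱼ ∑ₖ ηⱼₖ x⁽ʲ⁾ₖ`. -/
theorem integral_exp_multiMax_le {p : ℕ} (hp : 0 < p) {n : ℕ} (hn : 0 < n) {c : ℝ} (hc : 0 < c) :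
    Integrable (fun ξ =>
        Real.exp (c * Real.sqrt p * Real.sqrt n * multiMax (fun _ => isingCube n) ξ))
        (stdGaussianPi (Fin p → Fin n)) ∧
      ∫ ξ, Real.exp (c * Real.sqrt p * Real.sqrt n * multiMax (fun _ => isingCube n) ξ)
        ∂(stdGaussianPi (Fin p → Fin n))
      ≤ Real.exp (p * n * (c ^ 2 / 2 + Real.log (scaledErfc p c))) := by
  have hn' : (0 : ℝ) < n := by exact_mod_cast hn
  have hsn : 0 < Real.sqrt n := Real.sqrt_pos.2 hn'
  have hp' : (0 : ℝ) < p := by exact_mod_cast hp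
  have hsp : 0 < Real.sqrt p := Real.sqrt_pos.2 hp'
  have h := integral_exp_mul_selection_le (T := Fin p → isingCube n) (J := Fin p × Fin n)
    (a := fun x => tensorCoeff fun j => (x j : Fin n → ℝ))
    (b := fun x k => (x k.1 : Fin n → ℝ) k.2) (κ := p - 1)
    (r := 1 / Real.sqrt n) (l := c * Real.sqrt p * Real.sqrt n)
    (fun x => by
      rw [sum_tensorCoeff_mul, Fintype.sum_prod_type]
      simp [sum_mul_self_of_mem_isingCube hn (x _).2])
    (fun x y => by
      rw [sum_tensorCoeff_mul, Fintype.sum_prod_type]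
      have := sum_add_one_le_prod_add_card (Finset.univ : Finset (Fin p))
        fun j => abs_sum_mul_le_one (x j).2 (y j).2
      simp only [Finset.card_univ, Fintype.card_fin] at this
      linarith)
    (fun x k => (abs_apply_of_mem_isingCube (x k.1).2 k.2).le)
    (mul_pos (mul_pos hc hsp) hsn) (measurable_multiMax p n) exists_multiMax_eq
  refine ⟨h.1, h.2.trans (le_of_eq ?_)⟩
  rw [show c * Real.sqrt p * Real.sqrt n * (1 / Real.sqrt n) = c * Real.sqrt p by field_simp,
    integral_exp_mul_abs_eq_scaledErfc, ← Real.exp_nat_mul, ← Real.exp_add, mul_pow, mul_pow,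
    Real.sq_sqrt hn'.le, Real.sq_sqrt hp'.le, Fintype.card_prod, Fintype.card_fin,
    Fintype.card_fin]
  congr 1
  push_cast
  ring

end SpinFields

section Conclusions

/-- Jensen's inequality for the exponential, in the form of a bound on the mean. -/
theorem integral_le_div_of_integral_exp_le {Ω : Type*} [MeasurableSpace Ω] {P : Measure Ω}
    [IsProbabilityMeasure P] {X : Ω → ℝ} {l k : ℝ} (hl : 0 < l) (hX : Integrable X P)
    (hexp : Integrable (fun ω => Real.exp (l * X ω)) P)
    (h : ∫ ω, Real.exp (l * X ω) ∂P ≤ Real.exp k) : ∫ ω, X ω ∂P ≤ k / l := by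
  rw [le_div_iff₀ hl, mul_comm, ← integral_const_mul]
  have h1 : ∫ ω, l * X ω ∂P ≤ ∫ ω, (Real.exp (-k) * Real.exp (l * X ω) + (k - 1)) ∂P := by
    refine integral_mono (hX.const_mul l) ((hexp.const_mul _).add (integrable_const _)) fun ω => ?_
    have := Real.add_one_le_exp (-k + l * X ω)
    rw [Real.exp_add] at this
    change l * X ω ≤ _
    linarith
  rw [integral_add (hexp.const_mul _) (integrable_const _),
    integral_const_mul (Real.exp (-k))] at h1
  have h2 := mul_le_mul_of_nonneg_left h (Real.exp_pos (-k)).le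
  rw [← Real.exp_add, neg_add_cancel, Real.exp_zero] at h2
  simp only [integral_const, probReal_univ, smul_eq_mul, one_mul] at h1
  linarith

theorem integral_singleMax_le (p : ℕ) {n : ℕ} (hn : 0 < n) {c : ℝ} (hc : 0 < c) :
    1 / Real.sqrt n * ∫ ξ, singleMax (isingCube n) ξ ∂(stdGaussianPi (Fin p → Fin n))
      ≤ groundStateBound p c := by
  have hn' : (0 : ℝ) < n := by exact_mod_cast hn
  have hsn : 0 < Real.sqrt n := Real.sqrt_pos.2 hn'
  obtain ⟨h1, h2⟩ := integral_exp_singleMax_le p hn hc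
  have h := integral_le_div_of_integral_exp_le (mul_pos hc hsn) (integrable_singleMax p n) h1 h2
  refine (mul_le_mul_of_nonneg_left h (by positivity)).trans (le_of_eq ?_)
  rw [groundStateBound]
  field_simp
  rw [Real.sq_sqrt hn'.le]

theorem integral_multiMax_le {p : ℕ} (hp : 0 < p) {n : ℕ} (hn : 0 < n) {c : ℝ} (hc : 0 < c) :
    1 / Real.sqrt n * ∫ ξ, multiMax (fun _ => isingCube n) ξ ∂(stdGaussianPi (Fin p → Fin n))
      ≤ Real.sqrt p * groundStateBound p c := by
  have hn' : (0 : ℝ) < n := by exact_mod_cast hn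
  have hsn : 0 < Real.sqrt n := Real.sqrt_pos.2 hn'
  have hp' : (0 : ℝ) < p := by exact_mod_cast hp
  have hsp : 0 < Real.sqrt p := Real.sqrt_pos.2 hp'
  obtain ⟨h1, h2⟩ := integral_exp_multiMax_le hp hn hc
  have h := integral_le_div_of_integral_exp_le (mul_pos (mul_pos hc hsp) hsn)
    (integrable_multiMax p n) h1 h2
  refine (mul_le_mul_of_nonneg_left h (by positivity)).trans (le_of_eq ?_)
  rw [groundStateBound]
  field_simp
  rw [Real.sq_sqrt hn'.le, Real.sq_sqrt hp'.le]
  ring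

/-- The Chernoff bound for the ground state energy. -/
theorem measure_le_zeta_le (p : ℕ) {n : ℕ} (hn : 0 < n) (u : ℝ) {c : ℝ} (hc : 0 < c) :
    stdGaussianPi (Fin p → Fin n) {ξ | u ≤ zeta (isingCube n) ξ}
      ≤ ENNReal.ofReal (Real.exp (n * isingObjective p u c)) := by
  have hn' : (0 : ℝ) < n := by exact_mod_cast hn
  have hsn : 0 < Real.sqrt n := Real.sqrt_pos.2 hn'
  obtain ⟨h1, h2⟩ := integral_exp_singleMax_le p hn hc
  have he : ∀ ξ : (Fin p → Fin n) → ℝ, c * n * zeta (isingCube n) ξ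
      = c * Real.sqrt n * singleMax (isingCube n) ξ := fun ξ => by
    have : (n : ℝ) = Real.sqrt n * Real.sqrt n := (Real.mul_self_sqrt hn'.le).symm
    rw [zeta]
    nth_rewrite 1 [this]
    field_simp
  have h := measure_ge_le_exp_mul_mgf (μ := stdGaussianPi (Fin p → Fin n))
    (X := zeta (isingCube n)) u (t := c * n) (by positivity) (by simpa only [he] using h1)
  rw [← ofReal_measureReal]
  refine ENNReal.ofReal_le_ofReal (h.trans ?_)
  simp only [mgf, he]
  refine (mul_le_mul_of_nonneg_left h2 (Real.exp_pos _).le).trans (le_of_eq ?_)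
  rw [← Real.exp_add, isingObjective_eq]
  congr 1
  ring

theorem measurable_zeta (p n : ℕ) : Measurable (zeta (p := p) (isingCube n)) :=
  (measurable_singleMax p n).const_mul _

end Conclusions

end PSpin

end

theorem mainTheorem4 {Ω : Type*} [MeasurableSpace Ω] (P : Measure Ω) [IsProbabilityMeasure P]
    (p : ℕ) (hp : 2 ≤ p)
    (A : (n : ℕ) → (Fin p → Fin n) → Ω → ℝ)
    (hA_law : ∀ n i, HasLaw (A n i) (gaussianReal 0 1) P)
    (hA_indep : ∀ n, iIndepFun (A n) P) :
    -- the stationarity equation, the two forms of the rate, and the large deviation bound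
    (∀ u c : ℝ, PSpin.IsIsingArgmin p u c →
      c < u ∧
      1 / PSpin.erfc (-(c * Real.sqrt p) / Real.sqrt 2)
        = Real.exp (c ^ 2 * p / 2) * (u - c) * Real.sqrt (Real.pi / (2 * p)) ∧
      PSpin.isingPhi p u c
        = c ^ 2 / 2 + Real.log (PSpin.erfc (-(c * Real.sqrt p) / Real.sqrt 2)) - c * u ∧
      limsup (fun n : ℕ =>
          ENNReal.log (P {ω | u ≤ PSpin.zeta (PSpin.isingCube n) fun i => A n i ω}) / (n : EReal))
        atTop ≤ ((PSpin.isingPhi p u c : ℝ) : EReal)) ∧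
    -- the two descriptions of `u_GS`, and existence of the minimizer above it
    IsGLB (PSpin.negativeRateSet p) (PSpin.uGS p) ∧
    IsLeast ((fun c : ℝ =>
        c / 2 + 1 / c * Real.log (PSpin.erfc (-(c * Real.sqrt p) / Real.sqrt 2))) '' Ioi 0)
      (PSpin.uGS p) ∧
    (∀ u, PSpin.uGS p ≤ u → ∃ c, PSpin.IsIsingArgmin p u c) ∧
    -- the ground state energy of the Ising `p`-spin model
    (∀ n, Integrable (fun ω => PSpin.singleMax (PSpin.isingCube n) fun i => A n i ω) P) ∧
    limsup (fun n : ℕ =>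
        ((1 / Real.sqrt n *
          ∫ ω, PSpin.singleMax (PSpin.isingCube n) (fun i => A n i ω) ∂P : ℝ) : EReal))
      atTop ≤ ((PSpin.uGS p : ℝ) : EReal) ∧
    -- the ground state energy of the Ising multipartite `p`-spin model
    (∀ n, Integrable (fun ω => PSpin.multiMax (fun _ => PSpin.isingCube n) fun i => A n i ω) P) ∧
    limsup (fun n : ℕ =>
        ((1 / Real.sqrt n *
          ∫ ω, PSpin.multiMax (fun _ => PSpin.isingCube n) (fun i => A n i ω) ∂P : ℝ) : EReal))
      atTop ≤ ((Real.sqrt p * PSpin.uGS p : ℝ) : EReal) := by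
  have hlaw : ∀ n, HasLaw (fun ω i => A n i ω) (PSpin.stdGaussianPi (Fin p → Fin n)) P :=
    fun n => (hA_indep n).hasLaw_pi (hA_law n)
  have htransfer : ∀ n (f : ((Fin p → Fin n) → ℝ) → ℝ),
      Integrable f (PSpin.stdGaussianPi (Fin p → Fin n)) →
      Integrable (fun ω => f fun i => A n i ω) P := fun n f hf => by
    rw [← (hlaw n).map_eq] at hf
    exact hf.comp_aemeasurable (hlaw n).aemeasurable
  obtain ⟨⟨c, hc, hcu⟩, -⟩ := PSpin.isLeast_uGS hp
  rw [mem_Ioi] at hc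
  refine ⟨fun u c h => ⟨h.lt hp, h.one_div_scaledErfc hp, h.isingPhi_eq hp, ?_⟩,
    PSpin.isGLB_uGS hp, PSpin.isLeast_uGS hp, fun u => PSpin.exists_isIsingArgmin_of_uGS_le hp,
    fun n => htransfer n _ (PSpin.integrable_singleMax p n), ?_,
    fun n => htransfer n _ (PSpin.integrable_multiMax p n), ?_⟩
  · refine limsup_le_of_le (by isBoundedDefault) ?_
    filter_upwards [eventually_gt_atTop 0] with n hn
    have hn' : (0 : EReal) < (n : EReal) := by exact_mod_cast hn
    rw [EReal.div_le_iff_le_mul hn' (EReal.natCast_ne_top n),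
      (hlaw n).measure_eq (p := fun ξ => u ≤ PSpin.zeta (PSpin.isingCube n) ξ)
        (measurableSet_le measurable_const (PSpin.measurable_zeta p n)), h.isingPhi_eq hp]
    refine (ENNReal.log_le_log (PSpin.measure_le_zeta_le p hn u h.1)).trans (le_of_eq ?_)
    rw [ENNReal.log_ofReal_of_pos (Real.exp_pos _), Real.log_exp]
    norm_cast
  · refine limsup_le_of_le (by isBoundedDefault) ?_
    filter_upwards [eventually_gt_atTop 0] with n hn
    rw [EReal.coe_le_coe_iff, ← hcu]
    have := (hlaw n).integral_comp
      (PSpin.measurable_singleMax p n).aestronglyMeasurable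
    simp only [Function.comp_def] at this
    rw [this]
    exact PSpin.integral_singleMax_le p hn hc
  · refine limsup_le_of_le (by isBoundedDefault) ?_
    filter_upwards [eventually_gt_atTop 0] with n hn
    rw [EReal.coe_le_coe_iff, ← hcu]
    have := (hlaw n).integral_comp
      (PSpin.measurable_multiMax p n).aestronglyMeasurable
    simp only [Function.comp_def] at this
    rw [this]
    exact PSpin.integral_multiMax_le (by omega) hn hc
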